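/- Let $\mathcal O_2$ be the Cuntz algebra, that is, a (nonzero) unital $C^*$-algebra generated by two isometries $S_1,S_2$ with $S_1S_1^*+S_2S_2^*=1$. For a word $\mu=\mu_1\cdots\mu_k$ over $\{1,2\}$ $(k\ge 0)$ put $S_\mu=S_{\mu_1}\cdots S_{\mu_k}$, with $S_\emptyset=1$. Let $V\subseteq\mathcal U(\mathcal O_2)$ be the copy of the Thompson group $V$ consisting of all unitaries of $\mathcal O_2$ of the form $\sum_{(\alpha,\beta)\in\mathcal J}S_\alpha S_\beta^*$, where $\mathcal J$ is a finite set of pairs of words. For each unitary $u\in\mathcal U(\mathcal O_2)$ there is a unique unital $*$-endomorphism $\lambda_u$ of $\mathcal O_2$ with $\lambda_u(S_i)=uS_i$ for $i=1,2$, and $$\lambda_u(V)\subseteq V\quad\Longleftrightarrow\quad u\in V.$$ -/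

import Mathlib

open scoped BigOperators

/-- `A`, together with the elements `S 0, …, S (n - 1)`, is a copy of the Cuntz algebra `𝒪ₙ`:
the `S i` are isometries whose range projections sum to `1`, and they generate `A` as a
C⋆-algebra. -/
structure GeneratesCuntzAlgebra {A : Type*} [CStarAlgebra A] {n : ℕ} (S : Fin n → A) : Prop where
  isometry : ∀ i, star (S i) * S i = 1
  sum_range : ∑ i, S i * star (S i) = 1
  dense : Dense (StarAlgebra.adjoin ℂ (Set.range S) : Set A)

/-- `S_μ = S_{μ₁} ⋯ S_{μₖ}` for a multi-index `μ = μ₁ … μₖ`, with `S_∅ = 1`. -/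
def cuntzWord {A : Type*} [CStarAlgebra A] {n : ℕ} (S : Fin n → A) (μ : List (Fin n)) : A :=
  (μ.map S).prod

/-- The set `𝒱ₙ` of all finite sums `∑_{(α, β) ∈ J} S_α S_β⋆`, with `J` a finite set of pairs of
multi-indices. -/
def cuntzSums {A : Type*} [CStarAlgebra A] {n : ℕ} (S : Fin n → A) : Set A :=
  {w | ∃ J : Finset (List (Fin n) × List (Fin n)),
    w = ∑ p ∈ J, cuntzWord S p.1 * star (cuntzWord S p.2)}

/-- The Thompson group `V`, realised as the unitaries of `𝒪₂` that lie in `𝒱₂`. -/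
def thompsonV {A : Type*} [CStarAlgebra A] (S : Fin 2 → A) : Set A :=
  {w | w ∈ unitary A ∧ w ∈ cuntzSums S}

/-! Let `𝒪₂` act on `ℓ²` of the binary sequences that are not eventually periodic, `Sᵢ` putting the
letter `i` in front. The members of `V` are exactly the unitaries that are sums of monomials `S_α
S_β⋆`, repetitions allowed (`mem_thompsonV_iff`), and they permute the basis. Such sums form a cone
closed under products and adjoints, so `u ∈ V` gives `λ_u(V) ⊆ V` at once.

Conversely, if `λ_u(V) ⊆ V`, then `V` also acts through `λ_u` by permutations of the basis. The
elements `S₁S₁⋆ + S₀wS₀⋆` with `w ∈ V` fix `ξ = λ_u(S₁S₁⋆)δₓ`, so the coefficients of `ξ` are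
constant on the orbit of `x` under them. On an infinite orbit they vanish by square summability, and
`ξ = 0`. On a finite orbit, summing diagonal coefficients of `λ_u(S₀aS₀⋆)` gives a functional of `a`
invariant under conjugation by `V`; both halves of `S₀S₀⋆` are conjugate to it, so the functional
vanishes at `1` and `ξ = δₓ`. Thus `λ_u(SᵢSᵢ⋆)` is diagonal with entries 0 and 1
(`range_proj_apply_delta`). Approximation by a polynomial in the generators, whose diagonal depends
on finitely many letters, puts it in the cone (`mem_cuntzCone_of_apply_delta`). Elements of `V` and
these projections produce `S₀` and `S₁` (`zero_eq_branch`), so the cone contains `λ_u(Sᵢ)` and `u =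
∑ λ_u(Sᵢ)Sᵢ⋆`.

Existence of `λ_u` and faithfulness of the representation both rest on `norm_map_of_mem_adjoin`. -/

section CuntzFamily

/-! ### Calculus of words and of the canonical shift -/

variable {A : Type*} [CStarAlgebra A]

/-- Two isometries whose range projections sum to `1`. -/
structure IsCuntzFamily (S : Fin 2 → A) : Prop where
  isometry : ∀ i, star (S i) * S i = 1
  sum_range : S 0 * star (S 0) + S 1 * star (S 1) = 1

theorem cuntzWord_nil (S : Fin 2 → A) : cuntzWord S [] = 1 := by simp [cuntzWord]

theorem cuntzWord_cons (S : Fin 2 → A) (i : Fin 2) (μ : List (Fin 2)) :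
    cuntzWord S (i :: μ) = S i * cuntzWord S μ := by simp [cuntzWord]

theorem cuntzWord_append (S : Fin 2 → A) (μ ν : List (Fin 2)) :
    cuntzWord S (μ ++ ν) = cuntzWord S μ * cuntzWord S ν := by simp [cuntzWord]

theorem cuntzWord_singleton (S : Fin 2 → A) (i : Fin 2) : cuntzWord S [i] = S i := by
  simp [cuntzWord]

theorem map_cuntzWord {B F : Type*} [CStarAlgebra B] [FunLike F A B] [MonoidHomClass F A B]
    (ψ : F) (S : Fin 2 → A) (μ : List (Fin 2)) :
    ψ (cuntzWord S μ) = cuntzWord (fun i => ψ (S i)) μ := by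
  simp [cuntzWord, map_list_prod, Function.comp_def]

/-- The canonical endomorphism `x ↦ ∑ Sᵢ x Sᵢ⋆` of a Cuntz family. -/
def cuntzShift (S : Fin 2 → A) (x : A) : A := S 0 * x * star (S 0) + S 1 * x * star (S 1)

theorem star_cuntzShift (S : Fin 2 → A) (x : A) :
    star (cuntzShift S x) = cuntzShift S (star x) := by
  simp [cuntzShift, mul_assoc]

theorem cuntzShift_zero (S : Fin 2 → A) : cuntzShift S 0 = 0 := by
  simp [cuntzShift]

theorem star_cuntzShift_iterate (S : Fin 2 → A) (k : ℕ) (x : A) :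
    star ((cuntzShift S)^[k] x) = (cuntzShift S)^[k] (star x) := by
  induction k generalizing x with
  | zero => rfl
  | succ k ih => rw [Function.iterate_succ_apply, ih, star_cuntzShift, Function.iterate_succ_apply]

theorem cuntzShift_iterate_zero (S : Fin 2 → A) (k : ℕ) : (cuntzShift S)^[k] 0 = 0 :=
  Function.iterate_fixed (cuntzShift_zero S) k

namespace IsCuntzFamily

variable {S : Fin 2 → A} (hS : IsCuntzFamily S)
include hS

theorem star_zero_mul_one : star (S 0) * S 1 = 0 := by
  have h : star (S 0) * (S 0 * star (S 0) + S 1 * star (S 1)) * S 1 = star (S 0) * S 1 := by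
    rw [hS.sum_range, mul_one]
  have h' : star (S 0) * (S 0 * star (S 0) + S 1 * star (S 1)) * S 1
      = (star (S 0) * S 0) * (star (S 0) * S 1) + (star (S 0) * S 1) * (star (S 1) * S 1) := by
    noncomm_ring
  rw [h', hS.isometry, hS.isometry] at h
  simpa using h

theorem star_one_mul_zero : star (S 1) * S 0 = 0 := by
  simpa using congrArg star hS.star_zero_mul_one

theorem star_mul (i j : Fin 2) : star (S i) * S j = if i = j then 1 else 0 := by
  fin_cases i <;> fin_cases j <;>
    simp [hS.isometry, hS.star_zero_mul_one, hS.star_one_mul_zero]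

theorem star_mul_ne {i j : Fin 2} (h : i ≠ j) : star (S i) * S j = 0 := by
  rw [hS.star_mul, if_neg h]

theorem isometry_mul (i : Fin 2) (x : A) : star (S i) * (S i * x) = x := by
  rw [← mul_assoc, hS.isometry, one_mul]

theorem star_mul_ne_mul {i j : Fin 2} (h : i ≠ j) (x : A) : star (S i) * (S j * x) = 0 := by
  rw [← mul_assoc, hS.star_mul_ne h, zero_mul]

theorem star_zero_mul_one_mul (x : A) : star (S 0) * (S 1 * x) = 0 :=
  hS.star_mul_ne_mul (by decide) x

theorem star_one_mul_zero_mul (x : A) : star (S 1) * (S 0 * x) = 0 :=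
  hS.star_mul_ne_mul (by decide) x

theorem word_isometry (μ : List (Fin 2)) : star (cuntzWord S μ) * cuntzWord S μ = 1 := by
  induction μ with
  | nil => simp [cuntzWord_nil]
  | cons i μ ih => rw [cuntzWord_cons, StarMul.star_mul, mul_assoc, hS.isometry_mul, ih]

theorem star_word_mul_word (β γ : List (Fin 2)) :
    star (cuntzWord S β) * cuntzWord S γ = 0 ∨
    (∃ ν, γ = β ++ ν ∧ star (cuntzWord S β) * cuntzWord S γ = cuntzWord S ν) ∨
    (∃ ν, β = γ ++ ν ∧ star (cuntzWord S β) * cuntzWord S γ = star (cuntzWord S ν)) := by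
  induction β generalizing γ with
  | nil => exact Or.inr (Or.inl ⟨γ, by simp, by simp [cuntzWord_nil]⟩)
  | cons i β ih =>
    cases γ with
    | nil => exact Or.inr (Or.inr ⟨i :: β, by simp, by simp [cuntzWord_nil]⟩)
    | cons j γ =>
      by_cases hij : i = j
      · subst hij
        have h : star (cuntzWord S (i :: β)) * cuntzWord S (i :: γ)
            = star (cuntzWord S β) * cuntzWord S γ := by
          rw [cuntzWord_cons, cuntzWord_cons, StarMul.star_mul, mul_assoc, hS.isometry_mul]
        rw [h]
        rcases ih γ with h | ⟨ν, h1, h2⟩ | ⟨ν, h1, h2⟩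
        · exact Or.inl h
        · exact Or.inr (Or.inl ⟨ν, by simp [h1], h2⟩)
        · exact Or.inr (Or.inr ⟨ν, by simp [h1], h2⟩)
      · left
        rw [cuntzWord_cons, cuntzWord_cons, StarMul.star_mul, mul_assoc, hS.star_mul_ne_mul hij,
          mul_zero]

/-- One of `β`, `γ` must be a prefix of the other, or the product vanishes. The length identity
makes degree additive; the clause on equal lengths closes each matrix level under products. -/
theorem monomial_mul_monomial (α β γ δ : List (Fin 2)) :
    cuntzWord S α * star (cuntzWord S β) * (cuntzWord S γ * star (cuntzWord S δ)) = 0 ∨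
    ∃ μ ν, (μ.length : ℤ) - ν.length
        = ((α.length : ℤ) - β.length) + ((γ.length : ℤ) - δ.length) ∧
      (α.length = β.length → β.length = γ.length → γ.length = δ.length →
        μ.length = α.length ∧ ν.length = α.length) ∧
      cuntzWord S α * star (cuntzWord S β) * (cuntzWord S γ * star (cuntzWord S δ))
        = cuntzWord S μ * star (cuntzWord S ν) := by
  have e : cuntzWord S α * star (cuntzWord S β) * (cuntzWord S γ * star (cuntzWord S δ))
      = cuntzWord S α * (star (cuntzWord S β) * cuntzWord S γ) * star (cuntzWord S δ) := by
    noncomm_ring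
  rw [e]
  rcases hS.star_word_mul_word β γ with h | ⟨ν, rfl, h2⟩ | ⟨ν, rfl, h2⟩
  · left; simp [h]
  · right
    refine ⟨α ++ ν, δ, by simp; ring, fun h3 h4 h5 => ?_, ?_⟩
    · rw [List.length_append] at h4 h5 ⊢
      omega
    · rw [h2, cuntzWord_append]
  · right
    refine ⟨α, δ ++ ν, by simp; ring, fun h3 h4 h5 => ?_, ?_⟩
    · rw [List.length_append] at h3 h4 ⊢
      omega
    · rw [h2, cuntzWord_append, StarMul.star_mul, mul_assoc]

theorem monomial_eq_add (α β : List (Fin 2)) :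
    cuntzWord S α * star (cuntzWord S β)
      = cuntzWord S (α ++ [0]) * star (cuntzWord S (β ++ [0]))
        + cuntzWord S (α ++ [1]) * star (cuntzWord S (β ++ [1])) := by
  have : cuntzWord S α * star (cuntzWord S β)
      = cuntzWord S α * (S 0 * star (S 0) + S 1 * star (S 1)) * star (cuntzWord S β) := by
    rw [hS.sum_range, mul_one]
  rw [this]
  simp only [cuntzWord_append, cuntzWord_singleton, StarMul.star_mul]
  noncomm_ring

theorem shift_one : cuntzShift S 1 = 1 := by simpa [cuntzShift] using hS.sum_range

theorem shift_mul (x y : A) : cuntzShift S (x * y) = cuntzShift S x * cuntzShift S y := by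
  simp only [cuntzShift, add_mul, mul_add, mul_assoc, hS.isometry_mul, hS.star_zero_mul_one_mul,
    hS.star_one_mul_zero_mul]
  simp

theorem shift_iterate_one (k : ℕ) : (cuntzShift S)^[k] 1 = 1 :=
  Function.iterate_fixed hS.shift_one k

theorem shift_iterate_mul (k : ℕ) (x y : A) :
    (cuntzShift S)^[k] (x * y) = (cuntzShift S)^[k] x * (cuntzShift S)^[k] y := by
  induction k generalizing x y with
  | zero => rfl
  | succ k ih => simp only [Function.iterate_succ_apply, hS.shift_mul, ih]

theorem shift_mul_gen (i : Fin 2) (x : A) : cuntzShift S x * S i = S i * x := by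
  fin_cases i <;> simp [cuntzShift, add_mul, mul_assoc, hS.isometry, hS.star_zero_mul_one,
    hS.star_one_mul_zero]

theorem shift_iterate_mul_word (k : ℕ) (μ : List (Fin 2)) (x : A) :
    (cuntzShift S)^[k + μ.length] x * cuntzWord S μ
      = cuntzWord S μ * (cuntzShift S)^[k] x := by
  induction μ with
  | nil => simp [cuntzWord_nil]
  | cons i μ ih =>
    rw [List.length_cons, ← add_assoc, Function.iterate_succ_apply', cuntzWord_cons, ← mul_assoc,
      hS.shift_mul_gen, mul_assoc, ih, mul_assoc]

theorem star_word_mul_shift_iterate (k : ℕ) (μ : List (Fin 2)) (x : A) :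
    star (cuntzWord S μ) * (cuntzShift S)^[k + μ.length] x
      = (cuntzShift S)^[k] x * star (cuntzWord S μ) := by
  have := congrArg star (hS.shift_iterate_mul_word k μ (star x))
  simpa [star_cuntzShift_iterate] using this

theorem star_pow_mul_shift_iterate (k : ℕ) (x : A) :
    star (S 0) ^ k * (cuntzShift S)^[k] x = x * star (S 0) ^ k := by
  have := hS.star_word_mul_shift_iterate 0 (List.replicate k 0) x
  simpa [cuntzWord] using this

theorem star_pow_mul_pow (k : ℕ) : star (S 0) ^ k * S 0 ^ k = 1 := by
  have := hS.word_isometry (List.replicate k 0)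
  simpa [cuntzWord] using this

theorem isometry_pow_mul (d : ℕ) : star (S 0 ^ d * S 1) * (S 0 ^ d * S 1) = 1 := by
  rw [StarMul.star_mul, star_pow, mul_assoc, ← mul_assoc _ (S 0 ^ d), hS.star_pow_mul_pow,
    one_mul, hS.isometry]

/-- The isometry `S₀ᵈ S₁` has range orthogonal to its first `d` shifts. -/
theorem star_mul_shift_iterate_eq_zero {d j : ℕ} (hj : 1 ≤ j) (hjd : j ≤ d) :
    star (S 0 ^ d * S 1) * (cuntzShift S)^[j] (S 0 ^ d * S 1) = 0 := by
  obtain ⟨e, rfl⟩ := Nat.exists_eq_add_of_le' hjd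
  obtain ⟨j, rfl⟩ := Nat.exists_eq_add_of_le' hj
  have h1 : star (S 0) ^ (e + (j + 1)) * (cuntzShift S)^[j + 1] (S 0 ^ (e + (j + 1)) * S 1)
      = S 0 ^ (j + 1) * S 1 * star (S 0) ^ (j + 1) := by
    rw [pow_add, mul_assoc, hS.star_pow_mul_shift_iterate, pow_add (S 0)]
    simp only [← mul_assoc]
    rw [hS.star_pow_mul_pow, one_mul]
  rw [StarMul.star_mul, star_pow, mul_assoc, h1, pow_succ' (S 0)]
  simp only [mul_assoc, hS.star_one_mul_zero_mul]

/-- Nearby shifts of `S₀ᵈS₁` are isometries with orthogonal ranges. Compressing by two of them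
therefore detects the degree of a monomial. -/
theorem shift_iterate_star_mul {d : ℕ} (k l : ℕ) (h : ((k : ℤ) - l).natAbs ≤ d) :
    star ((cuntzShift S)^[k] (S 0 ^ d * S 1)) * (cuntzShift S)^[l] (S 0 ^ d * S 1)
      = if k = l then 1 else 0 := by
  rcases lt_trichotomy k l with hkl | rfl | hkl
  · obtain ⟨j, rfl⟩ := Nat.exists_eq_add_of_le hkl.le
    rw [if_neg hkl.ne, star_cuntzShift_iterate, Function.iterate_add_apply,
      ← hS.shift_iterate_mul, hS.star_mul_shift_iterate_eq_zero (by omega) (by omega),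
      cuntzShift_iterate_zero]
  · rw [if_pos rfl, star_cuntzShift_iterate, ← hS.shift_iterate_mul, hS.isometry_pow_mul,
      hS.shift_iterate_one]
  · obtain ⟨j, rfl⟩ := Nat.exists_eq_add_of_le hkl.le
    have := hS.star_mul_shift_iterate_eq_zero (d := d) (j := j) (by omega) (by omega)
    have := congrArg star this
    rw [StarMul.star_mul, star_star, star_zero, star_cuntzShift_iterate] at this
    rw [if_neg hkl.ne', star_cuntzShift_iterate, Function.iterate_add_apply,
      ← hS.shift_iterate_mul, this, cuntzShift_iterate_zero]

end IsCuntzFamily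

/-! ### Degrees, widths and matrix levels -/

/-- The span of the monomials `S_α S_β⋆` with `|α| - |β| = j`. -/
noncomputable def cuntzDegree (S : Fin 2 → A) (j : ℤ) : Submodule ℂ A :=
  Submodule.span ℂ {x | ∃ α β : List (Fin 2), (α.length : ℤ) - β.length = j ∧
    x = cuntzWord S α * star (cuntzWord S β)}

/-- The span of the monomials `S_α S_β⋆` with `||α| - |β|| ≤ d`. -/
noncomputable def cuntzWidth (S : Fin 2 → A) (d : ℕ) : Submodule ℂ A :=
  Submodule.span ℂ {x | ∃ α β : List (Fin 2), ((α.length : ℤ) - β.length).natAbs ≤ d ∧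
    x = cuntzWord S α * star (cuntzWord S β)}

/-- The span of the matrix units `S_α S_β⋆` with `|α| = |β| = k`. -/
noncomputable def cuntzLevel (S : Fin 2 → A) (k : ℕ) : Submodule ℂ A :=
  Submodule.span ℂ {x | ∃ α β : List (Fin 2), α.length = k ∧ β.length = k ∧
    x = cuntzWord S α * star (cuntzWord S β)}

theorem cuntzWidth_mono (S : Fin 2 → A) {d e : ℕ} (h : d ≤ e) :
    cuntzWidth S d ≤ cuntzWidth S e := by
  refine Submodule.span_mono ?_
  rintro _ ⟨α, β, h', rfl⟩
  exact ⟨α, β, h'.trans h, rfl⟩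

theorem star_mem_cuntzWidth (S : Fin 2 → A) {d : ℕ} {x : A} (hx : x ∈ cuntzWidth S d) :
    star x ∈ cuntzWidth S d := by
  induction hx using Submodule.span_induction with
  | mem x hx =>
    obtain ⟨α, β, h, rfl⟩ := hx
    exact Submodule.subset_span ⟨β, α, by omega, by simp⟩
  | zero => simp
  | add x y _ _ hx hy => rw [star_add]; exact add_mem hx hy
  | smul c x _ hx => rw [star_smul]; exact Submodule.smul_mem _ _ hx

theorem star_mem_cuntzDegree (S : Fin 2 → A) {j : ℤ} {x : A} (hx : x ∈ cuntzDegree S j) :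
    star x ∈ cuntzDegree S (-j) := by
  induction hx using Submodule.span_induction with
  | mem x hx =>
    obtain ⟨α, β, h, rfl⟩ := hx
    exact Submodule.subset_span ⟨β, α, by omega, by simp⟩
  | zero => simp
  | add x y _ _ hx hy => rw [star_add]; exact add_mem hx hy
  | smul c x _ hx => rw [star_smul]; exact Submodule.smul_mem _ _ hx

theorem exists_sum_of_mem_cuntzWidth (S : Fin 2 → A) {d : ℕ} {x : A} (hx : x ∈ cuntzWidth S d) :
    ∃ f : ℤ → A, (∀ j, f j ∈ cuntzDegree S j) ∧ x = ∑ j ∈ Finset.Icc (-d : ℤ) d, f j := by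
  have hle : cuntzWidth S d ≤ ⨆ j ∈ Finset.Icc (-d : ℤ) d, cuntzDegree S j := by
    refine Submodule.span_le.2 ?_
    rintro _ ⟨α, β, h, rfl⟩
    refine Submodule.mem_iSup_of_mem ((α.length : ℤ) - β.length)
      (Submodule.mem_iSup_of_mem ?_ (Submodule.subset_span ⟨α, β, rfl, rfl⟩))
    rw [Finset.mem_Icc]
    omega
  obtain ⟨μ, hμ⟩ := (Submodule.mem_iSup_finset_iff_exists_sum _ _).1 (hle hx)
  exact ⟨fun j => μ j, fun j => (μ j).2, hμ.symm⟩

namespace IsCuntzFamily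

variable {S : Fin 2 → A} (hS : IsCuntzFamily S)
include hS

theorem cuntzDegree_mul_mem {i j : ℤ} {x y : A} (hx : x ∈ cuntzDegree S i)
    (hy : y ∈ cuntzDegree S j) : x * y ∈ cuntzDegree S (i + j) := by
  have h := Submodule.mul_mem_mul hx hy
  rw [cuntzDegree, cuntzDegree, Submodule.span_mul_span] at h
  refine Submodule.span_le.2 ?_ h
  rintro _ ⟨_, ⟨α, β, h1, rfl⟩, _, ⟨γ, δ, h2, rfl⟩, rfl⟩
  rcases hS.monomial_mul_monomial α β γ δ with h | ⟨μ, ν, h3, -, h4⟩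
  · simp [h]
  · exact Submodule.subset_span ⟨μ, ν, by rw [h3, h1, h2], h4⟩

theorem cuntzWidth_mul_mem {d e : ℕ} {x y : A} (hx : x ∈ cuntzWidth S d)
    (hy : y ∈ cuntzWidth S e) : x * y ∈ cuntzWidth S (d + e) := by
  have h := Submodule.mul_mem_mul hx hy
  rw [cuntzWidth, cuntzWidth, Submodule.span_mul_span] at h
  refine Submodule.span_le.2 ?_ h
  rintro _ ⟨_, ⟨α, β, h1, rfl⟩, _, ⟨γ, δ, h2, rfl⟩, rfl⟩
  rcases hS.monomial_mul_monomial α β γ δ with h | ⟨μ, ν, h3, -, h4⟩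
  · simp [h]
  · exact Submodule.subset_span ⟨μ, ν, by rw [h3]; omega, h4⟩

omit hS in
theorem one_mem_cuntzWidth (d : ℕ) : (1 : A) ∈ cuntzWidth S d :=
  Submodule.subset_span ⟨[], [], by simp, by simp [cuntzWord_nil]⟩

theorem cuntzWidth_pow_mem {d : ℕ} {x : A} (hx : x ∈ cuntzWidth S d) (n : ℕ) :
    x ^ n ∈ cuntzWidth S (n * d) := by
  induction n with
  | zero => rw [pow_zero]; exact one_mem_cuntzWidth _
  | succ n ih =>
    rw [pow_succ, Nat.succ_mul]
    exact hS.cuntzWidth_mul_mem ih hx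

theorem exists_mem_cuntzWidth {x : A} (hx : x ∈ StarAlgebra.adjoin ℂ (Set.range S)) :
    ∃ d, x ∈ cuntzWidth S d := by
  induction hx using StarAlgebra.adjoin_induction with
  | mem x hx =>
    obtain ⟨i, rfl⟩ := hx
    exact ⟨1, Submodule.subset_span ⟨[i], [], by simp, by simp [cuntzWord]⟩⟩
  | algebraMap r =>
    exact ⟨0, by rw [Algebra.algebraMap_eq_smul_one];
                 exact Submodule.smul_mem _ _ (one_mem_cuntzWidth _)⟩
  | add x y _ _ hx hy =>
    obtain ⟨d, hd⟩ := hx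
    obtain ⟨e, he⟩ := hy
    exact ⟨max d e, add_mem (cuntzWidth_mono S (le_max_left _ _) hd)
      (cuntzWidth_mono S (le_max_right _ _) he)⟩
  | mul x y _ _ hx hy =>
    obtain ⟨d, hd⟩ := hx
    obtain ⟨e, he⟩ := hy
    exact ⟨_, hS.cuntzWidth_mul_mem hd he⟩
  | star x _ hx =>
    obtain ⟨d, hd⟩ := hx
    exact ⟨d, star_mem_cuntzWidth S hd⟩

theorem cuntzLevel_mono {k l : ℕ} (h : k ≤ l) : cuntzLevel S k ≤ cuntzLevel S l := by
  refine monotone_nat_of_le_succ (f := cuntzLevel S) (fun k => Submodule.span_le.2 ?_) h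
  rintro _ ⟨α, β, h1, h2, rfl⟩
  rw [hS.monomial_eq_add]
  exact add_mem (Submodule.subset_span ⟨_, _, by simp [h1], by simp [h2], rfl⟩)
    (Submodule.subset_span ⟨_, _, by simp [h1], by simp [h2], rfl⟩)

theorem exists_mem_cuntzLevel {x : A} (hx : x ∈ cuntzDegree S 0) : ∃ k, x ∈ cuntzLevel S k := by
  induction hx using Submodule.span_induction with
  | mem x hx =>
    obtain ⟨α, β, h, rfl⟩ := hx
    exact ⟨α.length, Submodule.subset_span ⟨α, β, rfl, by omega, rfl⟩⟩
  | zero => exact ⟨0, zero_mem _⟩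
  | add x y _ _ hx hy =>
    obtain ⟨d, hd⟩ := hx
    obtain ⟨e, he⟩ := hy
    exact ⟨max d e, add_mem (hS.cuntzLevel_mono (le_max_left _ _) hd)
      (hS.cuntzLevel_mono (le_max_right _ _) he)⟩
  | smul c x _ hx =>
    obtain ⟨d, hd⟩ := hx
    exact ⟨d, Submodule.smul_mem _ _ hd⟩

theorem one_mem_cuntzLevel (k : ℕ) : (1 : A) ∈ cuntzLevel S k :=
  hS.cuntzLevel_mono (Nat.zero_le k)
    (Submodule.subset_span ⟨[], [], rfl, rfl, by simp [cuntzWord_nil]⟩)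

theorem cuntzLevel_mul_mem {k : ℕ} {x y : A} (hx : x ∈ cuntzLevel S k)
    (hy : y ∈ cuntzLevel S k) : x * y ∈ cuntzLevel S k := by
  have h := Submodule.mul_mem_mul hx hy
  rw [cuntzLevel, Submodule.span_mul_span] at h
  refine Submodule.span_le.2 ?_ h
  rintro _ ⟨_, ⟨α, β, h1, h1', rfl⟩, _, ⟨γ, δ, h2, h2', rfl⟩, rfl⟩
  rcases hS.monomial_mul_monomial α β γ δ with h | ⟨μ, ν, -, h3, h4⟩
  · simp [h]
  · have := h3 (by omega) (by omega) (by omega)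
    exact Submodule.subset_span ⟨μ, ν, by omega, by omega, h4⟩

omit hS in
theorem star_mem_cuntzLevel {k : ℕ} {x : A} (hx : x ∈ cuntzLevel S k) :
    star x ∈ cuntzLevel S k := by
  induction hx using Submodule.span_induction with
  | mem x hx =>
    obtain ⟨α, β, h, h', rfl⟩ := hx
    exact Submodule.subset_span ⟨β, α, h', h, by simp⟩
  | zero => simp
  | add x y _ _ hx hy => rw [star_add]; exact add_mem hx hy
  | smul c x _ hx => rw [star_smul]; exact Submodule.smul_mem _ _ hx

/-- The matrix algebra spanned by the `S_α S_β⋆` with `|α| = |β| = k`. -/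
def levelSubalgebra (k : ℕ) : StarSubalgebra ℂ A where
  carrier := cuntzLevel S k
  mul_mem' := hS.cuntzLevel_mul_mem
  one_mem' := hS.one_mem_cuntzLevel k
  add_mem' := add_mem
  zero_mem' := zero_mem _
  algebraMap_mem' r := by
    rw [Algebra.algebraMap_eq_smul_one]
    exact Submodule.smul_mem _ _ (hS.one_mem_cuntzLevel k)
  star_mem' := star_mem_cuntzLevel

omit hS in
theorem finiteDimensional_cuntzLevel (k : ℕ) : FiniteDimensional ℂ (cuntzLevel S k) := by
  have hf : {l : List (Fin 2) | l.length = k}.Finite := List.finite_length_eq _ _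
  refine FiniteDimensional.span_of_finite ℂ (((hf.prod hf).image
    fun p => cuntzWord S p.1 * star (cuntzWord S p.2)).subset ?_)
  rintro _ ⟨α, β, h, h', rfl⟩
  exact ⟨(α, β), ⟨h, h'⟩, rfl⟩

theorem isClosed_levelSubalgebra (k : ℕ) : IsClosed (hS.levelSubalgebra k : Set A) := by
  have := finiteDimensional_cuntzLevel (S := S) k
  exact (cuntzLevel S k).closed_of_finiteDimensional

/-- The range projections of the words of length `k` sum to 1, so `x` is recovered from its matrix
entries. -/
theorem eq_zero_of_forall_word {k : ℕ} {x : A}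
    (h : ∀ α β : List (Fin 2), α.length = k → β.length = k →
      star (cuntzWord S α) * x * cuntzWord S β = 0) : x = 0 := by
  induction k generalizing x with
  | zero => simpa [cuntzWord_nil] using h [] [] rfl rfl
  | succ k ih =>
    have key : ∀ i j, star (S i) * x * S j = 0 := fun i j => ih fun α β hα hβ => by
      have := h (i :: α) (j :: β) (by simp [hα]) (by simp [hβ])
      rw [cuntzWord_cons, cuntzWord_cons, StarMul.star_mul] at this
      simpa only [mul_assoc] using this
    have e : x = (S 0 * star (S 0) + S 1 * star (S 1)) * x
        * (S 0 * star (S 0) + S 1 * star (S 1)) := by rw [hS.sum_range]; simp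
    have e' : (S 0 * star (S 0) + S 1 * star (S 1)) * x * (S 0 * star (S 0) + S 1 * star (S 1))
        = S 0 * (star (S 0) * x * S 0) * star (S 0) + S 0 * (star (S 0) * x * S 1) * star (S 1)
        + S 1 * (star (S 1) * x * S 0) * star (S 0)
        + S 1 * (star (S 1) * x * S 1) * star (S 1) := by
      noncomm_ring
    rw [e, e']
    simp [key]

theorem star_word_mul_mul_word_mem {k : ℕ} {x : A} (hx : x ∈ cuntzLevel S k)
    {α β : List (Fin 2)} (hα : α.length = k) (hβ : β.length = k) :
    ∃ c : ℂ, star (cuntzWord S α) * x * cuntzWord S β = c • 1 := by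
  induction hx using Submodule.span_induction with
  | mem x hx =>
    obtain ⟨γ, δ, h, h', rfl⟩ := hx
    have e : star (cuntzWord S α) * (cuntzWord S γ * star (cuntzWord S δ)) * cuntzWord S β
      = (star (cuntzWord S α) * cuntzWord S γ) * (star (cuntzWord S δ) * cuntzWord S β) := by
      noncomm_ring
    rw [e]
    have aux : ∀ μ ν : List (Fin 2), μ.length = ν.length →
        ∃ c : ℂ, star (cuntzWord S μ) * cuntzWord S ν = c • 1 := by
      intro μ ν hl
      rcases hS.star_word_mul_word μ ν with h | ⟨ρ, h1, h2⟩ | ⟨ρ, h1, h2⟩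
      · exact ⟨0, by simp [h]⟩
      · have : ρ = [] := List.length_eq_zero_iff.1 (by rw [h1] at hl; simp at hl; simp [hl])
        exact ⟨1, by rw [h2, this]; simp [cuntzWord_nil]⟩
      · have : ρ = [] := List.length_eq_zero_iff.1 (by rw [h1] at hl; simp at hl; simp [hl])
        exact ⟨1, by rw [h2, this]; simp [cuntzWord_nil]⟩
    obtain ⟨c, hc⟩ := aux α γ (by omega)
    obtain ⟨c', hc'⟩ := aux δ β (by omega)
    exact ⟨c * c', by rw [hc, hc', smul_mul_smul_comm, mul_one]⟩
  | zero => exact ⟨0, by simp⟩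
  | add x y _ _ hx hy =>
    obtain ⟨c, hc⟩ := hx
    obtain ⟨c', hc'⟩ := hy
    exact ⟨c + c', by rw [mul_add, add_mul, hc, hc', add_smul]⟩
  | smul c x _ hx =>
    obtain ⟨c', hc'⟩ := hx
    exact ⟨c * c', by rw [mul_smul_comm, smul_mul_assoc, hc', smul_smul]⟩

/-! ### Unital star homomorphisms are isometric on polynomials in a Cuntz family -/

section Hom

variable {B : Type*} [CStarAlgebra B] [Nontrivial B] (ψ : A →⋆ₐ[ℂ] B)

/-- The matrix entries of `x` are scalars, and a unital map into a nonzero algebra cannot kill a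
nonzero scalar. -/
theorem eq_zero_of_map_eq_zero {k : ℕ} {x : A} (hx : x ∈ cuntzLevel S k) (h : ψ x = 0) :
    x = 0 := by
  refine hS.eq_zero_of_forall_word (k := k) fun α β hα hβ => ?_
  obtain ⟨c, hc⟩ := hS.star_word_mul_mul_word_mem hx hα hβ
  have := congrArg ψ hc
  rw [map_mul, map_mul, h, mul_zero, zero_mul, map_smul, map_one] at this
  have : c = 0 := by simpa using this.symm
  simp [hc, this]

theorem norm_map_of_mem_cuntzLevel {k : ℕ} {x : A} (hx : x ∈ cuntzLevel S k) :
    ‖ψ x‖ = ‖x‖ := by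
  have : IsClosed (hS.levelSubalgebra k : Set A) := hS.isClosed_levelSubalgebra k
  have hinj : Function.Injective (ψ.comp (hS.levelSubalgebra k).subtype) := by
    rw [injective_iff_map_eq_zero]
    intro y hy
    exact Subtype.ext (hS.eq_zero_of_map_eq_zero ψ y.2 hy)
  exact NonUnitalStarAlgHom.norm_map (ψ.comp (hS.levelSubalgebra k).subtype) hinj ⟨x, hx⟩

/-- By the C⋆-identity it suffices to treat `x⋆x`, which has degree 0 and so lies in a matrix level.
-/
theorem norm_map_of_mem_cuntzDegree {j : ℤ} {x : A} (hx : x ∈ cuntzDegree S j) :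
    ‖ψ x‖ = ‖x‖ := by
  have h0 : star x * x ∈ cuntzDegree S 0 := by
    have := hS.cuntzDegree_mul_mem (star_mem_cuntzDegree S hx) hx
    simpa using this
  obtain ⟨k, hk⟩ := hS.exists_mem_cuntzLevel h0
  have := hS.norm_map_of_mem_cuntzLevel ψ hk
  rw [map_mul, map_star, CStarRing.norm_star_mul_self, CStarRing.norm_star_mul_self] at this
  exact (mul_self_inj (norm_nonneg _) (norm_nonneg _)).1 this

omit [Nontrivial B] in
-- Moving the two shifts past `S_α` and `S_β⋆` lowers their exponents to `K + p - |α|` and `K + q -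
-- |β|`. These agree exactly when the degree is `p - q`; otherwise the ranges are orthogonal. `K`
-- must be large enough for both exponents to be natural numbers.
theorem eventually_compress {d : ℕ} (p q : ℕ) {i : ℤ} {x : A} (hx : x ∈ cuntzDegree S i)
    (hd : (i - (p - q)).natAbs ≤ d) :
    ∀ᶠ K : ℕ in Filter.atTop,
      star ((cuntzShift S)^[K + p] (S 0 ^ d * S 1)) * x * (cuntzShift S)^[K + q] (S 0 ^ d * S 1)
        = if i = p - q then x else 0 := by
  induction hx using Submodule.span_induction with
  | mem x hx =>
    obtain ⟨α, β, h, rfl⟩ := hx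
    filter_upwards [Filter.eventually_ge_atTop (α.length + β.length)] with K hK
    obtain ⟨k, hk⟩ : ∃ k, K + p = k + α.length := ⟨K + p - α.length, by omega⟩
    obtain ⟨l, hl⟩ : ∃ l, K + q = l + β.length := ⟨K + q - β.length, by omega⟩
    have e : ∀ a b c d : A, a * (b * c) * d = (a * b) * (c * d) := fun a b c d => by noncomm_ring
    rw [hk, hl, e, star_cuntzShift_iterate, hS.shift_iterate_mul_word,
      hS.star_word_mul_shift_iterate, ← e, ← star_cuntzShift_iterate,
      mul_assoc, mul_assoc, ← mul_assoc _ _ (star _), hS.shift_iterate_star_mul k l (by omega)]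
    by_cases hkl : k = l
    · rw [if_pos hkl, if_pos (by omega), one_mul]
    · rw [if_neg hkl, if_neg (by omega), zero_mul, mul_zero]
  | zero => simp
  | add x y _ _ hx hy =>
    filter_upwards [hx, hy] with K h1 h2
    rw [mul_add, add_mul, h1, h2]
    split_ifs <;> simp
  | smul c x _ hx =>
    filter_upwards [hx] with K h1
    rw [mul_smul_comm, smul_mul_assoc, h1]
    split_ifs <;> simp

omit hS in
theorem norm_le_one_of_isometry {w : A} (h : star w * w = 1) : ‖w‖ ≤ 1 := by
  have h1 : ‖w‖ * ‖w‖ = ‖(1 : A)‖ := by rw [← CStarRing.norm_star_mul_self, h]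
  have h2 : ‖(1 : A)‖ ≤ 1 := by
    rcases subsingleton_or_nontrivial A with _ | _
    · rw [Subsingleton.elim (1 : A) 0, norm_zero]; exact zero_le_one
    · rw [CStarRing.norm_one]
  nlinarith [norm_nonneg w]

omit [Nontrivial B] in
theorem norm_map_component_le {d : ℕ} {f : ℤ → A} (hf : ∀ j, f j ∈ cuntzDegree S j)
    {j : ℤ} (hj : j ∈ Finset.Icc (-d : ℤ) d) :
    ‖ψ (f j)‖ ≤ ‖ψ (∑ i ∈ Finset.Icc (-d : ℤ) d, f i)‖ := by
  set x := ∑ i ∈ Finset.Icc (-d : ℤ) d, f i with hx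
  have hj' := Finset.mem_Icc.1 hj
  -- Shift exponents are natural numbers, so `j` is split into its positive and negative parts.
  set p := j.toNat
  set q := (-j).toNat
  have hpq : j = p - q := by omega
  -- Two degrees in `[-d, d]` differ by at most `2d`, whence the exponent of `S₀`.
  have hev : ∀ᶠ K : ℕ in Filter.atTop, ∀ i ∈ Finset.Icc (-d : ℤ) d,
      star ((cuntzShift S)^[K + p] (S 0 ^ (2 * d) * S 1)) * f i
        * (cuntzShift S)^[K + q] (S 0 ^ (2 * d) * S 1) = if i = p - q then f i else 0 := by
    rw [Filter.eventually_all_finset]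
    intro i hi
    have hi' := Finset.mem_Icc.1 hi
    exact hS.eventually_compress p q (hf i) (by omega)
  obtain ⟨K, hK⟩ := hev.exists
  have hcomp : star ((cuntzShift S)^[K + p] (S 0 ^ (2 * d) * S 1)) * x
        * (cuntzShift S)^[K + q] (S 0 ^ (2 * d) * S 1) = f j := by
    rw [hx, Finset.mul_sum, Finset.sum_mul, Finset.sum_congr rfl hK, ← hpq,
      Finset.sum_ite_eq' _ j, if_pos hj]
  have hn : ∀ k, ‖ψ ((cuntzShift S)^[k] (S 0 ^ (2 * d) * S 1))‖ ≤ 1 := fun k =>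
    norm_le_one_of_isometry (by
      rw [← map_star, ← map_mul, hS.shift_iterate_star_mul k k (by simp), if_pos rfl, map_one])
  rw [← hcomp, map_mul, map_mul, map_star]
  calc _ ≤ ‖star (ψ ((cuntzShift S)^[K + p] (S 0 ^ (2 * d) * S 1))) * ψ x‖
        * ‖ψ ((cuntzShift S)^[K + q] (S 0 ^ (2 * d) * S 1))‖ := norm_mul_le _ _
    _ ≤ ‖star (ψ ((cuntzShift S)^[K + p] (S 0 ^ (2 * d) * S 1))) * ψ x‖ :=
        mul_le_of_le_one_right (norm_nonneg _) (hn _)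
    _ ≤ ‖star (ψ ((cuntzShift S)^[K + p] (S 0 ^ (2 * d) * S 1)))‖ * ‖ψ x‖ := norm_mul_le _ _
    _ ≤ ‖ψ x‖ := mul_le_of_le_one_left (norm_nonneg _) (by rw [norm_star]; exact hn _)

theorem norm_le_mul_norm_map {d : ℕ} {x : A} (hx : x ∈ cuntzWidth S d) :
    ‖x‖ ≤ (2 * d + 1) * ‖ψ x‖ := by
  obtain ⟨f, hf, rfl⟩ := exists_sum_of_mem_cuntzWidth S hx
  calc ‖∑ j ∈ Finset.Icc (-d : ℤ) d, f j‖ ≤ ∑ j ∈ Finset.Icc (-d : ℤ) d, ‖f j‖ :=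
        norm_sum_le _ _
    _ ≤ ∑ _j ∈ Finset.Icc (-d : ℤ) d, ‖ψ (∑ i ∈ Finset.Icc (-d : ℤ) d, f i)‖ := by
        refine Finset.sum_le_sum fun j hj => ?_
        rw [← hS.norm_map_of_mem_cuntzDegree ψ (hf j)]
        exact hS.norm_map_component_le ψ hf hj
    _ = _ := by
        rw [Finset.sum_const, Int.card_Icc, nsmul_eq_mul]
        congr 1
        have : ((d : ℤ) + 1 - -d).toNat = 2 * d + 1 := by omega
        rw [this]
        push_cast
        ring

omit hS [Nontrivial B] in
-- If `a > b > 0`, then `(a / b) ^ 2 ^ n` outgrows any affine function of `2 ^ n`. This removes the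
-- width factor by passing to powers.
theorem le_of_forall_pow_le {a b c : ℝ} (hb : 0 ≤ b)
    (h : ∀ n : ℕ, a ^ 2 ^ n ≤ (c * 2 ^ n + 1) * b ^ 2 ^ n) : a ≤ b := by
  by_contra! hlt
  rcases hb.eq_or_lt with rfl | hb
  · have := h 0
    simp at this
    linarith
  have hr : 1 < a / b := (one_lt_div hb).2 hlt
  have h1 := (tendsto_pow_const_div_const_pow_of_one_lt 1 hr).const_mul c
  have h2 := tendsto_pow_const_div_const_pow_of_one_lt 0 hr
  have h3 := (h1.add h2).comp (tendsto_pow_atTop_atTop_of_one_lt (α := ℕ) (r := 2) one_lt_two)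
  rw [mul_zero, add_zero] at h3
  obtain ⟨n, hn⟩ := (h3.eventually (gt_mem_nhds zero_lt_one)).exists
  have hp : 0 < (a / b) ^ 2 ^ n := pow_pos (zero_lt_one.trans hr) _
  simp only [Function.comp_apply, pow_one, pow_zero, Nat.cast_pow, Nat.cast_ofNat] at hn
  rw [← mul_div_assoc, ← add_div, div_lt_one hp, div_pow, lt_div_iff₀ (pow_pos hb _)] at hn
  exact absurd (h n) (not_le.2 hn)

/-- A unital `*`-homomorphism is isometric on the `*`-algebra generated by a Cuntz family. -/
theorem norm_map_of_mem_adjoin {x : A} (hx : x ∈ StarAlgebra.adjoin ℂ (Set.range S)) :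
    ‖ψ x‖ = ‖x‖ := by
  refine le_antisymm (NonUnitalStarAlgHom.norm_apply_le ψ x) ?_
  obtain ⟨d, hd⟩ := hS.exists_mem_cuntzWidth hx
  have hy : star x * x ∈ cuntzWidth S (d + d) :=
    hS.cuntzWidth_mul_mem (star_mem_cuntzWidth S hd) hd
  have key : ‖star x * x‖ ≤ ‖ψ (star x * x)‖ := by
    -- The power `2 ^ n` of `x⋆x` has width `2 ^ n * 2d`, so the factor is `4d * 2 ^ n + 1`.
    -- Self-adjointness turns norms of powers into powers of norms.
    refine le_of_forall_pow_le (c := 4 * d) (norm_nonneg _) fun n => ?_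
    have h := hS.norm_le_mul_norm_map ψ (hS.cuntzWidth_pow_mem hy (2 ^ n))
    have hsa : IsSelfAdjoint (star x * x) := IsSelfAdjoint.star_mul_self x
    rw [map_pow, hsa.norm_pow_two_pow, (hsa.map ψ).norm_pow_two_pow] at h
    convert h using 2
    push_cast
    ring
  rw [map_mul, map_star, CStarRing.norm_star_mul_self, CStarRing.norm_star_mul_self] at key
  exact (mul_self_le_mul_self_iff (norm_nonneg _) (norm_nonneg _)).2 key

end Hom

end IsCuntzFamily

end CuntzFamily

/-! ### Uniqueness and existence of homomorphisms out of the Cuntz algebra -/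

section Universal

variable {A : Type*} [CStarAlgebra A]

theorem GeneratesCuntzAlgebra.isCuntzFamily {S : Fin 2 → A} (hS : GeneratesCuntzAlgebra S) :
    IsCuntzFamily S :=
  ⟨hS.isometry, by simpa [Fin.sum_univ_two] using hS.sum_range⟩

theorem IsCuntzFamily.unitary_mul {S : Fin 2 → A} (hS : IsCuntzFamily S) {u : A}
    (hu : u ∈ unitary A) : IsCuntzFamily fun i => u * S i := by
  obtain ⟨h1, h2⟩ := Unitary.mem_iff.1 hu
  constructor
  · intro i
    rw [StarMul.star_mul, mul_assoc, ← mul_assoc _ u, h1, one_mul, hS.isometry]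
  · simp only [StarMul.star_mul]
    have : u * S 0 * (star (S 0) * star u) + u * S 1 * (star (S 1) * star u)
        = u * (S 0 * star (S 0) + S 1 * star (S 1)) * star u := by noncomm_ring
    rw [this, hS.sum_range, mul_one, h2]

/-- `*`-homomorphisms out of a Cuntz algebra are determined by the generators. -/
theorem GeneratesCuntzAlgebra.hom_ext {B : Type*} [CStarAlgebra B] {S : Fin 2 → A}
    (hS : GeneratesCuntzAlgebra S) {l l' : A →⋆ₐ[ℂ] B} (h : ∀ i, l (S i) = l' (S i)) : l = l' := by
  have hc : ∀ l : A →⋆ₐ[ℂ] B, Continuous l := fun l =>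
    AddMonoidHomClass.continuous_of_bound l 1 fun x => by
      rw [one_mul]; exact NonUnitalStarAlgHom.norm_apply_le l x
  have heq : Set.EqOn l l' (StarAlgebra.adjoin ℂ (Set.range S) : Set A) := by
    have : StarAlgebra.adjoin ℂ (Set.range S) ≤ StarAlgHom.equalizer l l' := by
      refine StarAlgebra.adjoin_le ?_
      rintro _ ⟨i, rfl⟩
      exact h i
    exact this
  exact DFunLike.coe_injective (Continuous.ext_on hS.dense (hc l) (hc l') heq)

/-- Universal property and simplicity of the Cuntz algebra. -/
theorem GeneratesCuntzAlgebra.exists_hom [Nontrivial A] {B : Type*} [CStarAlgebra B] [Nontrivial B]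
    {S : Fin 2 → A} (hS : GeneratesCuntzAlgebra S) {T : Fin 2 → B} (hT : IsCuntzFamily T) :
    ∃ l : A →⋆ₐ[ℂ] B, (∀ i, l (S i) = T i) ∧ ∀ x, ‖l x‖ = ‖x‖ := by
  let U : Fin 2 → A × B := fun i => (S i, T i)
  have hU : IsCuntzFamily U :=
    ⟨fun i => Prod.ext (hS.isometry i) (hT.isometry i),
      Prod.ext hS.isCuntzFamily.sum_range hT.sum_range⟩
  -- This is the graph of the desired map. Both coordinate projections are isometric on it, and the
  -- first one is onto.
  let G := (StarAlgebra.adjoin ℂ (Set.range U)).topologicalClosure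
  have : IsClosed (G : Set (A × B)) := StarSubalgebra.isClosed_topologicalClosure _
  have hfst : ∀ x ∈ G, ‖x.1‖ = ‖x‖ := by
    have hcl : IsClosed {x : A × B | ‖x.1‖ = ‖x‖} := isClosed_eq (by fun_prop) (by fun_prop)
    exact fun x hx => closure_minimal
      (fun y hy => hU.norm_map_of_mem_adjoin (StarAlgHom.fst ℂ A B) hy) hcl hx
  have hsnd : ∀ x ∈ G, ‖x.2‖ = ‖x‖ := by
    have hcl : IsClosed {x : A × B | ‖x.2‖ = ‖x‖} := isClosed_eq (by fun_prop) (by fun_prop)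
    exact fun x hx => closure_minimal
      (fun y hy => hU.norm_map_of_mem_adjoin (StarAlgHom.snd ℂ A B) hy) hcl hx
  let φ : G →⋆ₐ[ℂ] A := (StarAlgHom.fst ℂ A B).comp G.subtype
  have hiso : Isometry φ := AddMonoidHomClass.isometry_of_norm φ fun x => hfst x x.2
  have hmem : ∀ i, U i ∈ G := fun i =>
    StarSubalgebra.le_topologicalClosure _ (StarAlgebra.subset_adjoin ℂ _ ⟨i, rfl⟩)
  have hsurj : Function.Surjective φ := by
    have hcl : IsClosed (Set.range φ) := hiso.isClosedEmbedding.isClosed_range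
    have hle : StarAlgebra.adjoin ℂ (Set.range S) ≤ φ.range := by
      refine StarAlgebra.adjoin_le ?_
      rintro _ ⟨i, rfl⟩
      exact ⟨⟨U i, hmem i⟩, rfl⟩
    have hd : Dense (Set.range φ) := hS.dense.mono hle
    rw [← Set.range_eq_univ, ← hcl.closure_eq, hd.closure_eq]
  let e := StarAlgEquiv.ofBijective φ ⟨hiso.injective, hsurj⟩
  let e' : A →⋆ₐ[ℂ] G := e.symm
  refine ⟨((StarAlgHom.snd ℂ A B).comp G.subtype).comp e', fun i => ?_, fun x => ?_⟩
  · have : e' (S i) = ⟨U i, hmem i⟩ := e.symm_apply_apply ⟨U i, hmem i⟩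
    change (e' (S i) : A × B).2 = T i
    rw [this]
  · change ‖(e' x : A × B).2‖ = ‖x‖
    rw [hsnd _ (e' x).2, ← hfst _ (e' x).2]
    exact congrArg norm (e.apply_symm_apply x)

end Universal

/-! ### Aperiodic paths and the representation on their `ℓ²` space -/

section PathSpace

/-- Sequences in `{0, 1}` that are not eventually periodic. -/
def FreePath : Type :=
  {x : ℕ → Fin 2 // ∀ m n, (∀ k, x (m + k) = x (n + k)) → m = n}

namespace FreePath

/-- The sequence obtained by putting a letter in front of another one. -/
def consFun (i : Fin 2) (x : ℕ → Fin 2) : ℕ → Fin 2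
  | 0 => i
  | n + 1 => x n

/-- Putting a letter in front of a path. -/
def cons (i : Fin 2) (x : FreePath) : FreePath :=
  ⟨consFun i x.1, fun m n h => x.2 m n fun k => h (k + 1)⟩

/-- Removing the first letter of a path. -/
def tail (x : FreePath) : FreePath :=
  ⟨fun n => x.1 (n + 1), fun m n h => by
    have := x.2 (m + 1) (n + 1) fun k => by
      have := h k
      rwa [show m + 1 + k = m + k + 1 by ring, show n + 1 + k = n + k + 1 by ring]
    omega⟩

theorem cons_tail (x : FreePath) : cons (x.1 0) x.tail = x := by
  apply Subtype.ext
  funext n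
  cases n <;> rfl

theorem exists_eq_cons (x : FreePath) : ∃ i y, x = cons i y := ⟨_, _, x.cons_tail.symm⟩

theorem cons_inj {i j : Fin 2} {x y : FreePath} (h : cons i x = cons j y) : i = j ∧ x = y := by
  have h' : ∀ n, consFun i x.1 n = consFun j y.1 n := fun n => congrFun (congrArg Subtype.val h) n
  exact ⟨h' 0, Subtype.ext (funext fun n => h' (n + 1))⟩

/-- Putting a word in front of a path. -/
def prepend : List (Fin 2) → FreePath → FreePath
  | [], x => x
  | i :: α, x => cons i (prepend α x)

theorem prepend_apply_length_add (α : List (Fin 2)) (x : FreePath) (k : ℕ) :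
    (prepend α x).1 (α.length + k) = x.1 k := by
  induction α with
  | nil => simp [prepend]
  | cons i α ih =>
    rw [List.length_cons, show α.length + 1 + k = α.length + k + 1 by ring]
    exact ih

theorem prepend_append (α β : List (Fin 2)) (x : FreePath) :
    prepend (α ++ β) x = prepend α (prepend β x) := by
  induction α with
  | nil => rfl
  | cons i α ih => exact congrArg (cons i) ih

theorem eq_of_prepend_eq_of_length_eq {α β : List (Fin 2)} {x y : FreePath}
    (hl : α.length = β.length) (h : prepend α x = prepend β y) : α = β ∧ x = y := by
  induction α generalizing β with
  | nil =>
    obtain rfl := List.length_eq_zero_iff.1 hl.symm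
    exact ⟨rfl, h⟩
  | cons i α ih =>
    cases β with
    | nil => simp at hl
    | cons j β =>
      obtain ⟨rfl, h1⟩ := cons_inj h
      obtain ⟨rfl, h2⟩ := ih (by simpa using hl) h1
      exact ⟨rfl, h2⟩

/-- Aperiodicity enters here: words of different lengths would give one sequence two equal tails.
Hence `S_α S_β⋆` with `α ≠ β` has zero diagonal. -/
theorem eq_of_prepend_eq {α β : List (Fin 2)} {x : FreePath}
    (h : prepend α x = prepend β x) : α = β := by
  have hl : α.length = β.length := (prepend α x).2 _ _ fun k => by
    rw [prepend_apply_length_add, h, prepend_apply_length_add]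
  exact (eq_of_prepend_eq_of_length_eq hl h).1

theorem exists_eq_prepend (k : ℕ) (x : FreePath) : ∃ α y, α.length = k ∧ x = prepend α y := by
  induction k generalizing x with
  | zero => exact ⟨[], x, rfl, rfl⟩
  | succ k ih =>
    obtain ⟨i, y, rfl⟩ := x.exists_eq_cons
    obtain ⟨α, z, h, rfl⟩ := ih y
    exact ⟨i :: α, z, by simp [h], rfl⟩

instance : Nonempty FreePath := by
  classical
  refine ⟨⟨fun n => if IsSquare n then 1 else 0, ?_⟩⟩
  have key : ∀ m n : ℕ, (∀ k, (if IsSquare (m + k) then (1 : Fin 2) else 0)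
      = if IsSquare (n + k) then 1 else 0) → ¬ m < n := by
    intro m n h hlt
    -- The indicator of the squares is used. This shift compares position `n²` with `n² + n - m`,
    -- which lies strictly between `n²` and `(n + 1)²`.
    have h1 := h (n * n - m)
    have hm : m ≤ n * n := by nlinarith
    rw [Nat.add_sub_cancel' hm, if_pos ⟨n, rfl⟩] at h1
    split_ifs at h1 with h2
    · obtain ⟨r, hr⟩ := h2
      have h3 : n * n < r * r := by omega
      have h4 : r * r < (n + 1) * (n + 1) := by
        have : (n + 1) * (n + 1) = n * n + n + n + 1 := by ring
        omega
      have h5 := Nat.mul_self_lt_mul_self_iff.1 h3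
      have h6 := Nat.mul_self_lt_mul_self_iff.1 h4
      omega
    · exact absurd h1 (by decide)
  intro m n h
  rcases lt_trichotomy m n with hlt | rfl | hlt
  · exact absurd hlt (key m n h)
  · rfl
  · exact absurd hlt (key n m fun k => (h k).symm)

end FreePath

/-- Square summable functions on the set of paths. -/
noncomputable abbrev PathSpace : Type := lp (fun _ : FreePath => ℂ) 2

namespace PathSpace

open FreePath

open scoped Classical in
/-- The basis vector at a path. -/
noncomputable def delta (x : FreePath) : PathSpace := lp.single 2 x (1 : ℂ)

theorem inner_delta_left (x : FreePath) (f : PathSpace) : inner ℂ (delta x) f = f x := by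
  classical
  rw [delta, lp.inner_single_left]
  simp

theorem inner_delta_delta_self (x : FreePath) : inner ℂ (delta x) (delta x) = (1 : ℂ) := by
  classical
  rw [inner_delta_left, delta, lp.single_apply_self]

theorem inner_delta_delta_of_ne {x y : FreePath} (h : x ≠ y) :
    inner ℂ (delta x) (delta y) = (0 : ℂ) := by
  classical
  rw [inner_delta_left, delta, lp.single_apply_ne _ _ _ h]

theorem norm_delta (x : FreePath) : ‖delta x‖ = 1 := by
  classical
  rw [delta, lp.norm_single (by norm_num), norm_one]

theorem orthonormal_delta : Orthonormal ℂ delta :=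
  ⟨norm_delta, fun _ _ h => inner_delta_delta_of_ne h⟩

theorem delta_injective : Function.Injective delta := by
  intro x y h
  by_contra hne
  have := inner_delta_delta_of_ne hne
  rw [h, inner_delta_delta_self] at this
  exact one_ne_zero this

theorem delta_ne_zero (x : FreePath) : delta x ≠ 0 := by
  rw [← norm_ne_zero_iff, norm_delta]
  exact one_ne_zero

theorem ext_inner {f g : PathSpace} (h : ∀ x, inner ℂ (delta x) f = (inner ℂ (delta x) g : ℂ)) :
    f = g := by
  apply lp.ext
  funext x
  simpa only [inner_delta_left] using h x

/-- Values of an operator on the basis are coefficients of its adjoint, and coefficients determine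
vectors. -/
theorem clm_ext {a b : PathSpace →L[ℂ] PathSpace} (h : ∀ x, a (delta x) = b (delta x)) :
    a = b := by
  have key : star a = star b := by
    ext1 f
    refine ext_inner fun x => ?_
    rw [ContinuousLinearMap.star_eq_adjoint, ContinuousLinearMap.star_eq_adjoint,
      ContinuousLinearMap.adjoint_inner_right, ContinuousLinearMap.adjoint_inner_right, h]
  exact star_injective key

theorem inner_star_apply (a : PathSpace →L[ℂ] PathSpace) (f g : PathSpace) :
    inner ℂ f (star a g) = (inner ℂ (a f) g : ℂ) := by
  rw [ContinuousLinearMap.star_eq_adjoint, ContinuousLinearMap.adjoint_inner_right]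

theorem inner_star_apply_left (a : PathSpace →L[ℂ] PathSpace) (f g : PathSpace) :
    inner ℂ (star a f) g = (inner ℂ f (a g) : ℂ) := by
  rw [ContinuousLinearMap.star_eq_adjoint, ContinuousLinearMap.adjoint_inner_left]

instance : Nontrivial PathSpace := ⟨delta (Classical.arbitrary _), 0, delta_ne_zero _⟩

theorem orthonormal_delta_cons (i : Fin 2) : Orthonormal ℂ fun x => delta (cons i x) :=
  orthonormal_delta.comp _ fun _ _ h => (cons_inj h).2

/-- The isometry that puts a letter in front of each path. -/
noncomputable def creation (i : Fin 2) : PathSpace →L[ℂ] PathSpace :=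
  (orthonormal_delta_cons i).orthogonalFamily.linearIsometry.toContinuousLinearMap

theorem creation_delta (i : Fin 2) (x : FreePath) : creation i (delta x) = delta (cons i x) := by
  classical
  have := (orthonormal_delta_cons i).orthogonalFamily.linearIsometry_apply_single (i := x) (1 : ℂ)
  rw [LinearIsometry.toSpanSingleton_apply, one_smul] at this
  rw [← this, creation, delta]
  simp only [LinearIsometry.coe_toContinuousLinearMap]

theorem star_creation_delta_self (i : Fin 2) (x : FreePath) :
    star (creation i) (delta (cons i x)) = delta x := by
  refine ext_inner fun y => ?_
  rw [inner_star_apply, creation_delta]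
  by_cases h : y = x
  · rw [h, inner_delta_delta_self, inner_delta_delta_self]
  · rw [inner_delta_delta_of_ne h, inner_delta_delta_of_ne fun h' => h (cons_inj h').2]

theorem star_creation_delta_of_ne {i j : Fin 2} (h : i ≠ j) (x : FreePath) :
    star (creation i) (delta (cons j x)) = 0 := by
  refine ext_inner fun y => ?_
  rw [inner_star_apply, creation_delta, inner_zero_right,
    inner_delta_delta_of_ne fun h' => h (cons_inj h').1]

theorem isCuntzFamily_creation : IsCuntzFamily creation := by
  constructor
  · intro i
    refine clm_ext fun x => ?_
    rw [mul_apply_eq_comp, creation_delta, star_creation_delta_self]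
    rfl
  · refine clm_ext fun x => ?_
    obtain ⟨i, y, rfl⟩ := x.exists_eq_cons
    rw [add_apply, mul_apply_eq_comp,
      mul_apply_eq_comp, one_apply_eq_self]
    fin_cases i
    · simp only [Fin.zero_eta]
      rw [star_creation_delta_self, star_creation_delta_of_ne (by decide), map_zero, add_zero,
        creation_delta]
    · simp only [Fin.mk_one]
      rw [star_creation_delta_self, star_creation_delta_of_ne (by decide), map_zero, zero_add,
        creation_delta]

theorem word_delta (α : List (Fin 2)) (x : FreePath) :
    cuntzWord creation α (delta x) = delta (prepend α x) := by
  induction α with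
  | nil => rw [cuntzWord_nil]; rfl
  | cons i α ih => rw [cuntzWord_cons, mul_apply_eq_comp, ih, creation_delta]; rfl

theorem star_word_delta_prepend (α : List (Fin 2)) (x : FreePath) :
    star (cuntzWord creation α) (delta (prepend α x)) = delta x := by
  rw [← word_delta, ← mul_apply_eq_comp, isCuntzFamily_creation.word_isometry]
  rfl

theorem star_word_delta_of_forall_ne {α : List (Fin 2)} {x : FreePath}
    (h : ∀ y, x ≠ prepend α y) : star (cuntzWord creation α) (delta x) = 0 := by
  refine ext_inner fun y => ?_
  rw [inner_star_apply, word_delta, inner_zero_right, inner_delta_delta_of_ne (h y).symm]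

theorem monomial_delta (α β : List (Fin 2)) (x : FreePath) :
    (cuntzWord creation α * star (cuntzWord creation β)) (delta x) = 0 ∨
    ∃ y, x = prepend β y ∧
      (cuntzWord creation α * star (cuntzWord creation β)) (delta x) = delta (prepend α y) := by
  rw [mul_apply_eq_comp]
  by_cases h : ∃ y, x = prepend β y
  · obtain ⟨y, rfl⟩ := h
    exact Or.inr ⟨y, rfl, by rw [star_word_delta_prepend, word_delta]⟩
  · push Not at h
    exact Or.inl (by rw [star_word_delta_of_forall_ne h, map_zero])

/-- Diagonal matrix coefficients of a finite sum of monomials are determined by finitely many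
letters. -/
theorem exists_forall_inner_prepend_eq {d : ℕ} {b : PathSpace →L[ℂ] PathSpace}
    (hb : b ∈ cuntzWidth creation d) :
    ∃ k, ∀ l ≥ k, ∀ μ : List (Fin 2), μ.length = l → ∀ x y : FreePath,
      inner ℂ (delta (prepend μ x)) (b (delta (prepend μ x)))
        = (inner ℂ (delta (prepend μ y)) (b (delta (prepend μ y))) : ℂ) := by
  induction hb using Submodule.span_induction with
  | mem b hb =>
    obtain ⟨α, β, -, rfl⟩ := hb
    -- Once `μ` is at least as long as `α`, whether `μx` begins with `α` depends on `μ` alone.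
    refine ⟨α.length, fun l hl μ hμ => ?_⟩
    by_cases hαβ : α = β
    · subst hαβ
      have key : ∀ x y : FreePath, (∃ z, prepend μ x = prepend α z) →
          ∃ z, prepend μ y = prepend α z := by
        rintro x y ⟨z, hz⟩
        obtain ⟨ν, w, hν, rfl⟩ := z.exists_eq_prepend (l - α.length)
        rw [← prepend_append] at hz
        obtain ⟨rfl, -⟩ := eq_of_prepend_eq_of_length_eq (by simp; omega) hz
        exact ⟨prepend ν y, prepend_append _ _ _⟩
      have val : ∀ x, (∃ z, x = prepend α z) → inner ℂ (delta x)
          ((cuntzWord creation α * star (cuntzWord creation α)) (delta x)) = (1 : ℂ) := by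
        rintro _ ⟨z, rfl⟩
        rw [mul_apply_eq_comp, star_word_delta_prepend, word_delta,
          inner_delta_delta_self]
      have val' : ∀ x, (¬ ∃ z, x = prepend α z) → inner ℂ (delta x)
          ((cuntzWord creation α * star (cuntzWord creation α)) (delta x)) = (0 : ℂ) := by
        intro x hx
        push Not at hx
        rw [mul_apply_eq_comp, star_word_delta_of_forall_ne hx, map_zero,
          inner_zero_right]
      intro x y
      by_cases hx : ∃ z, prepend μ x = prepend α z
      · rw [val _ hx, val _ (key x y hx)]
      · rw [val' _ hx, val' _ fun hy => hx (key y x hy)]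
    · have val : ∀ x, inner ℂ (delta x)
          ((cuntzWord creation α * star (cuntzWord creation β)) (delta x)) = (0 : ℂ) := by
        intro x
        rcases monomial_delta α β x with h | ⟨y, rfl, h⟩
        · rw [h, inner_zero_right]
        · rw [h, inner_delta_delta_of_ne fun h' => hαβ (eq_of_prepend_eq h').symm]
      intro x y
      rw [val, val]
  | zero => exact ⟨0, fun l _ μ _ x y => by simp⟩
  | add b c _ _ hb hc =>
    obtain ⟨k, hk⟩ := hb
    obtain ⟨k', hk'⟩ := hc
    refine ⟨max k k', fun l hl μ hμ x y => ?_⟩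
    rw [add_apply, add_apply, inner_add_right,
      inner_add_right, hk l (le_of_max_le_left hl) μ hμ x y,
      hk' l (le_of_max_le_right hl) μ hμ x y]
  | smul c b _ hb =>
    obtain ⟨k, hk⟩ := hb
    refine ⟨k, fun l hl μ hμ x y => ?_⟩
    rw [smul_apply, smul_apply, inner_smul_right,
      inner_smul_right, hk l hl μ hμ x y]

end PathSpace

end PathSpace

/-! ### The cone of monomials -/

section Cone

variable {A : Type*} [CStarAlgebra A]

/-- The additive monoid generated by the monomials `S_α S_β⋆`. -/
noncomputable def cuntzCone (S : Fin 2 → A) : AddSubmonoid A :=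
  AddSubmonoid.closure {x | ∃ α β : List (Fin 2), x = cuntzWord S α * star (cuntzWord S β)}

theorem monomial_mem_cuntzCone (S : Fin 2 → A) (α β : List (Fin 2)) :
    cuntzWord S α * star (cuntzWord S β) ∈ cuntzCone S :=
  AddSubmonoid.subset_closure ⟨α, β, rfl⟩

theorem one_mem_cuntzCone (S : Fin 2 → A) : (1 : A) ∈ cuntzCone S := by
  simpa [cuntzWord_nil] using monomial_mem_cuntzCone S [] []

theorem gen_mem_cuntzCone (S : Fin 2 → A) (i : Fin 2) : S i ∈ cuntzCone S := by
  simpa [cuntzWord_nil, cuntzWord_singleton] using monomial_mem_cuntzCone S [i] []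

theorem star_mem_cuntzCone {S : Fin 2 → A} {x : A} (hx : x ∈ cuntzCone S) :
    star x ∈ cuntzCone S := by
  induction hx using AddSubmonoid.closure_induction with
  | mem x hx =>
    obtain ⟨α, β, rfl⟩ := hx
    simpa using monomial_mem_cuntzCone S β α
  | zero => simp
  | add x y _ _ hx hy => rw [star_add]; exact add_mem hx hy

theorem IsCuntzFamily.cuntzCone_mul_mem {S : Fin 2 → A} (hS : IsCuntzFamily S) {x y : A}
    (hx : x ∈ cuntzCone S) (hy : y ∈ cuntzCone S) : x * y ∈ cuntzCone S := by
  induction hx using AddSubmonoid.closure_induction with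
  | mem x hx =>
    obtain ⟨α, β, rfl⟩ := hx
    induction hy using AddSubmonoid.closure_induction with
    | mem y hy =>
      obtain ⟨γ, δ, rfl⟩ := hy
      rcases hS.monomial_mul_monomial α β γ δ with h | ⟨μ, ν, -, -, h⟩
      · rw [h]; exact zero_mem _
      · rw [h]; exact monomial_mem_cuntzCone S μ ν
    | zero => simp
    | add x y _ _ hx hy => rw [mul_add]; exact add_mem hx hy
  | zero => simp
  | add x y _ _ hx hy => rw [add_mul]; exact add_mem hx hy

theorem exists_multiset_of_mem_cuntzCone {S : Fin 2 → A} {x : A} (hx : x ∈ cuntzCone S) :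
    ∃ M : Multiset (List (Fin 2) × List (Fin 2)),
      x = (M.map fun p => cuntzWord S p.1 * star (cuntzWord S p.2)).sum := by
  induction hx using AddSubmonoid.closure_induction with
  | mem x hx =>
    obtain ⟨α, β, rfl⟩ := hx
    exact ⟨{(α, β)}, by simp⟩
  | zero => exact ⟨0, by simp⟩
  | add x y _ _ hx hy =>
    obtain ⟨M, rfl⟩ := hx
    obtain ⟨M', rfl⟩ := hy
    exact ⟨M + M', by simp⟩

theorem mem_cuntzCone_of_mem_cuntzSums {S : Fin 2 → A} {x : A} (hx : x ∈ cuntzSums S) :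
    x ∈ cuntzCone S := by
  obtain ⟨J, rfl⟩ := hx
  exact sum_mem fun p _ => monomial_mem_cuntzCone S p.1 p.2

/-- A `*`-homomorphism sending the generators into the cone of another family maps the cone into
that cone. -/
theorem map_mem_cuntzCone {B : Type*} [CStarAlgebra B] {S : Fin 2 → A} {T : Fin 2 → B}
    (hT : IsCuntzFamily T) (l : A →⋆ₐ[ℂ] B) (hl : ∀ i, l (S i) ∈ cuntzCone T) {x : A}
    (hx : x ∈ cuntzCone S) : l x ∈ cuntzCone T := by
  have hw : ∀ α, l (cuntzWord S α) ∈ cuntzCone T := by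
    intro α
    induction α with
    | nil => rw [cuntzWord_nil, map_one]; exact one_mem_cuntzCone T
    | cons i α ih => rw [cuntzWord_cons, map_mul]; exact hT.cuntzCone_mul_mem (hl i) ih
  induction hx using AddSubmonoid.closure_induction with
  | mem x hx =>
    obtain ⟨α, β, rfl⟩ := hx
    rw [map_mul, map_star]
    exact hT.cuntzCone_mul_mem (hw α) (star_mem_cuntzCone (hw β))
  | zero => simp
  | add x y _ _ hx hy => rw [map_add]; exact add_mem hx hy

/-- Since the range projections of the words of length `k` sum to 1, `a` is the sum of the `(a S_μ)
S_μ⋆`. -/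
theorem IsCuntzFamily.mem_cuntzCone_of_forall_mul_word {S : Fin 2 → A} (hS : IsCuntzFamily S)
    {a : A} {k : ℕ} (h : ∀ μ : List (Fin 2), μ.length = k → a * cuntzWord S μ ∈ cuntzCone S) :
    a ∈ cuntzCone S := by
  induction k generalizing a with
  | zero => simpa [cuntzWord_nil] using h [] rfl
  | succ k ih =>
    have h' : ∀ i, a * S i ∈ cuntzCone S := fun i => ih fun μ hμ => by
      have := h (i :: μ) (by simp [hμ])
      rwa [cuntzWord_cons, ← mul_assoc] at this
    have e : a = a * S 0 * star (S 0) + a * S 1 * star (S 1) := by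
      rw [mul_assoc, mul_assoc, ← mul_add, hS.sum_range, mul_one]
    rw [e]
    exact add_mem (hS.cuntzCone_mul_mem (h' 0) (star_mem_cuntzCone (gen_mem_cuntzCone S 0)))
      (hS.cuntzCone_mul_mem (h' 1) (star_mem_cuntzCone (gen_mem_cuntzCone S 1)))

/-! ### Unitaries in the cone permute the basis -/

namespace PathSpace

open FreePath

theorem norm_map_unitary_apply (ρ : A →⋆ₐ[ℂ] (PathSpace →L[ℂ] PathSpace)) {w : A}
    (hw : w ∈ unitary A) (f : PathSpace) : ‖ρ w f‖ = ‖f‖ := by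
  have h : inner ℂ (ρ w f) (ρ w f) = (inner ℂ f f : ℂ) := by
    rw [← inner_star_apply, ← map_star, ← mul_apply_eq_comp, ← map_mul,
      (Unitary.mem_iff.1 hw).1, map_one]
    rfl
  rw [inner_self_eq_norm_sq_to_K, inner_self_eq_norm_sq_to_K] at h
  have h' : ‖ρ w f‖ ^ 2 = ‖f‖ ^ 2 := by exact_mod_cast h
  exact (sq_eq_sq₀ (norm_nonneg _) (norm_nonneg _)).1 h'

theorem re_inner_delta_sum_nonneg (y : FreePath) (N : Multiset FreePath) :
    0 ≤ (inner ℂ (delta y) (N.map delta).sum : ℂ).re := by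
  induction N using Multiset.induction with
  | empty => simp
  | cons z N ih =>
    rw [Multiset.map_cons, Multiset.sum_cons, inner_add_right, Complex.add_re]
    refine add_nonneg ?_ ih
    by_cases h : y = z
    · rw [h, inner_delta_delta_self]; simp
    · rw [inner_delta_delta_of_ne h]; simp

/-- Inner products of basis vectors are nonnegative, so cross terms only increase the norm. -/
theorem card_le_norm_sum_sq (N : Multiset FreePath) :
    (N.card : ℝ) ≤ ‖(N.map delta).sum‖ ^ 2 := by
  induction N using Multiset.induction with
  | empty => simp
  | cons z N ih =>
    have h := re_inner_delta_sum_nonneg z N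
    rw [Multiset.map_cons, Multiset.sum_cons, Multiset.card_cons, @norm_add_sq ℂ, norm_delta]
    simp only [RCLike.re_to_complex]
    push_cast
    linarith

theorem exists_multiset_apply_delta {S : Fin 2 → A} (π : A →⋆ₐ[ℂ] (PathSpace →L[ℂ] PathSpace))
    (hπ : ∀ i, π (S i) = creation i) {r : A} (hr : r ∈ cuntzCone S) (x : FreePath) :
    ∃ N : Multiset FreePath, π r (delta x) = (N.map delta).sum := by
  induction hr using AddSubmonoid.closure_induction with
  | mem r hr =>
    obtain ⟨α, β, rfl⟩ := hr
    rw [map_mul, map_star, map_cuntzWord, map_cuntzWord, funext hπ]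
    rcases monomial_delta α β x with h | ⟨y, -, h⟩
    · exact ⟨0, by rw [h]; simp⟩
    · exact ⟨{prepend α y}, by rw [h]; simp⟩
  | zero => exact ⟨0, by simp⟩
  | add x y _ _ hx hy =>
    obtain ⟨M, hM⟩ := hx
    obtain ⟨M', hM'⟩ := hy
    exact ⟨M + M', by rw [map_add, add_apply, hM, hM']; simp⟩

theorem exists_apply_delta_eq {S : Fin 2 → A} (π : A →⋆ₐ[ℂ] (PathSpace →L[ℂ] PathSpace))
    (hπ : ∀ i, π (S i) = creation i) {w : A} (hw : w ∈ unitary A) (hw' : w ∈ cuntzCone S)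
    (x : FreePath) : ∃ y, π w (delta x) = delta y := by
  obtain ⟨N, hN⟩ := exists_multiset_apply_delta π hπ hw' x
  have hn : ‖(N.map delta).sum‖ = 1 := by rw [← hN, norm_map_unitary_apply π hw, norm_delta]
  have hc := card_le_norm_sum_sq N
  rw [hn, one_pow] at hc
  have hc' : N.card ≤ 1 := by exact_mod_cast hc
  have h0 : N.card ≠ 0 := by
    intro h
    rw [Multiset.card_eq_zero.1 h] at hn
    simp at hn
  obtain ⟨y, rfl⟩ := Multiset.card_eq_one.1 (by omega : N.card = 1)
  exact ⟨y, by rw [hN]; simp⟩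

/-- A repeated pair `(α, β)` would send a basis vector `δ_{βx}` to a sum of at least two basis
vectors, of norm above 1. So a unitary in the cone needs no repetitions. -/
theorem mem_thompsonV_iff {S : Fin 2 → A} (π : A →⋆ₐ[ℂ] (PathSpace →L[ℂ] PathSpace))
    (hπ : ∀ i, π (S i) = creation i) {w : A} :
    w ∈ thompsonV S ↔ w ∈ unitary A ∧ w ∈ cuntzCone S := by
  refine ⟨fun h => ⟨h.1, mem_cuntzCone_of_mem_cuntzSums h.2⟩, fun ⟨h1, h2⟩ => ⟨h1, ?_⟩⟩
  obtain ⟨M, hM⟩ := exists_multiset_of_mem_cuntzCone h2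
  have hnodup : M.Nodup := by
    rw [Multiset.nodup_iff_ne_cons_cons]
    rintro ⟨α, β⟩ M' rfl
    have hr : (M'.map fun p => cuntzWord S p.1 * star (cuntzWord S p.2)).sum ∈ cuntzCone S := by
      refine AddSubmonoid.multiset_sum_mem _ _ fun a ha => ?_
      obtain ⟨p, -, rfl⟩ := Multiset.mem_map.1 ha
      exact monomial_mem_cuntzCone S _ _
    obtain ⟨x⟩ := (inferInstance : Nonempty FreePath)
    obtain ⟨N, hN⟩ := exists_multiset_apply_delta π hπ hr (prepend β x)
    have hp : π (cuntzWord S α * star (cuntzWord S β)) (delta (prepend β x))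
        = delta (prepend α x) := by
      rw [map_mul, map_star, map_cuntzWord, map_cuntzWord, funext hπ, mul_apply_eq_comp,
        star_word_delta_prepend, word_delta]
    have hs : π w (delta (prepend β x))
        = ((prepend α x ::ₘ prepend α x ::ₘ N).map delta).sum := by
      rw [hM, Multiset.map_cons, Multiset.map_cons, Multiset.sum_cons, Multiset.sum_cons,
        map_add, map_add, add_apply, add_apply, hp, hN]
      simp
    have hc := card_le_norm_sum_sq (prepend α x ::ₘ prepend α x ::ₘ N)
    rw [← hs, norm_map_unitary_apply π h1, norm_delta] at hc
    simp only [Multiset.card_cons] at hc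
    push_cast at hc
    have : (0 : ℝ) ≤ N.card := Nat.cast_nonneg _
    linarith
  exact ⟨⟨M, hnodup⟩, hM⟩

end PathSpace

/-! ### Special elements of the Thompson group -/

/-- The element of the Thompson group exchanging the two halves. -/
noncomputable def cuntzFlip (S : Fin 2 → A) : A := S 0 * star (S 1) + S 1 * star (S 0)

/-- The element of the Thompson group given by `0 ↦ 0i`, `10 ↦ 0j`, `11 ↦ 1`. -/
noncomputable def cuntzBranch (S : Fin 2 → A) (i j : Fin 2) : A :=
  S 0 * S i * star (S 0) + S 0 * S j * (star (S 0) * star (S 1)) + S 1 * (star (S 1) * star (S 1))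

/-- The endomorphism `w ↦ S₁ S₁⋆ + S₀ w S₀⋆`, acting on one half only. -/
noncomputable def cuntzHalf (S : Fin 2 → A) (w : A) : A := S 1 * star (S 1) + S 0 * w * star (S 0)

theorem cuntzFlip_mem_cuntzCone {S : Fin 2 → A} (hS : IsCuntzFamily S) :
    cuntzFlip S ∈ cuntzCone S := by
  have h := gen_mem_cuntzCone S
  have h' := fun i => star_mem_cuntzCone (h i)
  exact add_mem (hS.cuntzCone_mul_mem (h _) (h' _)) (hS.cuntzCone_mul_mem (h _) (h' _))

theorem cuntzBranch_mem_cuntzCone {S : Fin 2 → A} (hS : IsCuntzFamily S) (i j : Fin 2) :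
    cuntzBranch S i j ∈ cuntzCone S := by
  have h := gen_mem_cuntzCone S
  have h' := fun i => star_mem_cuntzCone (h i)
  have m := @IsCuntzFamily.cuntzCone_mul_mem _ _ _ hS
  exact add_mem (add_mem (m (m (h _) (h _)) (h' _)) (m (m (h _) (h _)) (m (h' _) (h' _))))
    (m (h _) (m (h' _) (h' _)))

theorem cuntzHalf_mem_cuntzCone {S : Fin 2 → A} (hS : IsCuntzFamily S) {w : A}
    (hw : w ∈ cuntzCone S) : cuntzHalf S w ∈ cuntzCone S := by
  have h := gen_mem_cuntzCone S
  have h' := fun i => star_mem_cuntzCone (h i)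
  have m := @IsCuntzFamily.cuntzCone_mul_mem _ _ _ hS
  exact add_mem (m (h _) (h' _)) (m (m (h _) hw) (h' _))

theorem star_cuntzHalf (S : Fin 2 → A) (w : A) : star (cuntzHalf S w) = cuntzHalf S (star w) := by
  simp [cuntzHalf, mul_assoc]

namespace IsCuntzFamily

variable {S : Fin 2 → A} (hS : IsCuntzFamily S)
include hS

theorem cuntzFlip_mem_unitary : cuntzFlip S ∈ unitary A := by
  rw [Unitary.mem_iff]
  constructor <;>
  · simp only [cuntzFlip, star_add, StarMul.star_mul, star_star, add_mul, mul_add, mul_assoc,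
      hS.isometry_mul, hS.star_zero_mul_one_mul, hS.star_one_mul_zero_mul, mul_zero, add_zero,
      zero_add]
    first
      | exact hS.sum_range
      | (rw [add_comm]; exact hS.sum_range)

theorem cuntzBranch_mul_zero (i j : Fin 2) : cuntzBranch S i j * S 0 = S 0 * S i := by
  simp [cuntzBranch, add_mul, mul_assoc, hS.isometry, hS.star_one_mul_zero]

theorem cuntzBranch_mem_unitary {i j : Fin 2} (hij : i ≠ j) : cuntzBranch S i j ∈ unitary A := by
  have hsum : S i * star (S i) + S j * star (S j) = 1 := by
    rw [← hS.sum_range]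
    fin_cases i <;> fin_cases j <;> first | exact absurd rfl hij | simp [add_comm]
  rw [Unitary.mem_iff]
  constructor
  · simp only [cuntzBranch, star_add, StarMul.star_mul, star_star, add_mul, mul_add, mul_assoc,
      hS.isometry_mul, hS.star_zero_mul_one_mul, hS.star_one_mul_zero_mul, mul_zero, add_zero,
      zero_add, hS.star_mul_ne_mul hij, hS.star_mul_ne_mul hij.symm]
    have e : S 0 * star (S 0) + S 1 * (S 0 * (star (S 0) * star (S 1)))
        + S 1 * (S 1 * (star (S 1) * star (S 1)))
        = S 0 * star (S 0) + S 1 * (S 0 * star (S 0) + S 1 * star (S 1)) * star (S 1) := by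
      noncomm_ring
    rw [e, hS.sum_range, mul_one, hS.sum_range]
  · simp only [cuntzBranch, star_add, StarMul.star_mul, star_star, add_mul, mul_add, mul_assoc,
      hS.isometry_mul, hS.star_zero_mul_one_mul, hS.star_one_mul_zero_mul, mul_zero, add_zero,
      zero_add]
    have e : S 0 * (S i * (star (S i) * star (S 0))) + S 0 * (S j * (star (S j) * star (S 0)))
        + S 1 * star (S 1)
        = S 0 * (S i * star (S i) + S j * star (S j)) * star (S 0) + S 1 * star (S 1) := by
      noncomm_ring
    rw [e, hsum, mul_one, hS.sum_range]

theorem cuntzHalf_mul (v w : A) : cuntzHalf S v * cuntzHalf S w = cuntzHalf S (v * w) := by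
  simp only [cuntzHalf, add_mul, mul_add, mul_assoc, hS.isometry_mul, hS.star_zero_mul_one_mul,
    hS.star_one_mul_zero_mul, mul_zero, add_zero, zero_add]

theorem cuntzHalf_one : cuntzHalf S 1 = 1 := by
  rw [cuntzHalf, mul_one, add_comm, hS.sum_range]

theorem cuntzHalf_mem_unitary {w : A} (hw : w ∈ unitary A) : cuntzHalf S w ∈ unitary A := by
  obtain ⟨h1, h2⟩ := Unitary.mem_iff.1 hw
  exact Unitary.mem_iff.2 ⟨by rw [star_cuntzHalf, hS.cuntzHalf_mul, h1, hS.cuntzHalf_one],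
    by rw [star_cuntzHalf, hS.cuntzHalf_mul, h2, hS.cuntzHalf_one]⟩

theorem cuntzHalf_mul_one (w : A) : cuntzHalf S w * S 1 = S 1 := by
  simp [cuntzHalf, add_mul, mul_assoc, hS.isometry, hS.star_zero_mul_one]

theorem cuntzHalf_mul_zero (w : A) : cuntzHalf S w * S 0 = S 0 * w := by
  simp [cuntzHalf, add_mul, mul_assoc, hS.isometry, hS.star_one_mul_zero]

/-- The generator is not unitary, but on each half it agrees with an element of `V`. Control of `V`
and of the two range projections thus gives control of `S₀`. -/
theorem zero_eq_branch :
    S 0 = cuntzBranch S 0 1 * (S 0 * star (S 0))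
      + cuntzBranch S 1 0 * cuntzFlip S * (S 1 * star (S 1)) := by
  have hf : cuntzFlip S * S 1 = S 0 := by
    simp [cuntzFlip, add_mul, mul_assoc, hS.isometry, hS.star_zero_mul_one]
  have e : cuntzBranch S 1 0 * cuntzFlip S * (S 1 * star (S 1))
      = cuntzBranch S 1 0 * (cuntzFlip S * S 1) * star (S 1) := by noncomm_ring
  rw [e, hf, ← mul_assoc, hS.cuntzBranch_mul_zero, hS.cuntzBranch_mul_zero, mul_assoc, mul_assoc,
    ← mul_add, hS.sum_range, mul_one]

theorem one_eq_flip_mul : S 1 = cuntzFlip S * S 0 := by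
  simp [cuntzFlip, add_mul, mul_assoc, hS.isometry, hS.star_one_mul_zero]

theorem branch_conj {i j : Fin 2} :
    cuntzBranch S i j * (S 0 * star (S 0)) * star (cuntzBranch S i j)
      = S 0 * (S i * star (S i)) * star (S 0) := by
  have e : cuntzBranch S i j * (S 0 * star (S 0)) * star (cuntzBranch S i j)
      = cuntzBranch S i j * S 0 * star (cuntzBranch S i j * S 0) := by
    rw [StarMul.star_mul]; noncomm_ring
  rw [e, hS.cuntzBranch_mul_zero, StarMul.star_mul]
  noncomm_ring

theorem flip_conj :
    cuntzFlip S * (S 0 * star (S 0)) * star (cuntzFlip S) = S 1 * star (S 1) := by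
  have e : cuntzFlip S * (S 0 * star (S 0)) * star (cuntzFlip S)
      = cuntzFlip S * S 0 * star (cuntzFlip S * S 0) := by
    rw [StarMul.star_mul]; noncomm_ring
  rw [e, ← hS.one_eq_flip_mul]

end IsCuntzFamily

end Cone

/-! ### Rigidity of permutation actions of the Thompson group -/

section Main

variable {A : Type*} [CStarAlgebra A]

namespace PathSpace

open FreePath

section Permuting

variable {S : Fin 2 → A} (hS : IsCuntzFamily S) (ρ : A →⋆ₐ[ℂ] (PathSpace →L[ℂ] PathSpace))
  (hρ : ∀ w ∈ unitary A, w ∈ cuntzCone S → ∀ x, ∃ y, ρ w (delta x) = delta y)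
include hS hρ

/-- The trace over a finite invariant set of paths is invariant under conjugation. -/
theorem sum_inner_conj_eq {F : Finset FreePath}
    (hF : ∀ w ∈ unitary A, w ∈ cuntzCone S → ∀ y ∈ F, ∀ z,
      ρ (cuntzHalf S w) (delta y) = delta z → z ∈ F)
    {w : A} (hw : w ∈ unitary A) (hw' : w ∈ cuntzCone S) (a : A) :
    ∑ y ∈ F, inner ℂ (delta y) (ρ (S 0 * (w * a * star w) * star (S 0)) (delta y))
      = ∑ y ∈ F, (inner ℂ (delta y) (ρ (S 0 * a * star (S 0)) (delta y)) : ℂ) := by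
  have hsw : star w ∈ unitary A := Unitary.star_mem hw
  have hsw' : star w ∈ cuntzCone S := star_mem_cuntzCone hw'
  choose σ hσ using hρ _ (hS.cuntzHalf_mem_unitary hsw) (cuntzHalf_mem_cuntzCone hS hsw')
  have hmaps : Set.MapsTo σ F F := fun y hy => hF _ hsw hsw' y hy _ (hσ y)
  have hinj : Function.Injective σ := by
    intro y z hyz
    have h : ρ (cuntzHalf S (star w)) (delta y) = ρ (cuntzHalf S (star w)) (delta z) := by
      rw [hσ, hσ, hyz]
    have h' := congrArg (ρ (cuntzHalf S w)) h
    rw [← mul_apply_eq_comp, ← mul_apply_eq_comp, ← map_mul, hS.cuntzHalf_mul,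
      (Unitary.mem_iff.1 hw).2, hS.cuntzHalf_one, map_one] at h'
    exact delta_injective h'
  refine Finset.sum_nbij σ hmaps hinj.injOn
    (Finset.surjOn_of_injOn_of_card_le σ hmaps hinj.injOn le_rfl) fun y _ => ?_
  -- Conjugating `a` by `w` inside the first half is conjugation by `cuntzHalf S w`, which permutes
  -- `F`.
  have e : S 0 * (w * a * star w) * star (S 0)
      = star (cuntzHalf S (star w)) * (S 0 * a * star (S 0)) * cuntzHalf S (star w) := by
    have e1 : S 0 * (w * a * star w) * star (S 0) = S 0 * w * a * star (S 0 * w) := by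
      rw [StarMul.star_mul]; noncomm_ring
    rw [e1, ← hS.cuntzHalf_mul_zero, StarMul.star_mul, star_cuntzHalf, star_cuntzHalf, star_star]
    noncomm_ring
  rw [e, map_mul, map_mul, map_star, mul_apply_eq_comp, mul_apply_eq_comp, hσ, inner_star_apply, hσ]

/-- There is no conjugation invariant trace on the Cuntz algebra, so the first half acts as zero
on a finite invariant set of paths. -/
theorem star_zero_apply_eq_zero {F : Finset FreePath}
    (hF : ∀ w ∈ unitary A, w ∈ cuntzCone S → ∀ y ∈ F, ∀ z,
      ρ (cuntzHalf S w) (delta y) = delta z → z ∈ F) {x : FreePath} (hx : x ∈ F) :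
    star (ρ (S 0)) (delta x) = 0 := by
  set τ : A → ℂ := fun a =>
    ∑ y ∈ F, (inner ℂ (delta y) (ρ (S 0 * a * star (S 0)) (delta y)) : ℂ) with hτ
  have hadd : ∀ a b, τ (a + b) = τ a + τ b := by
    intro a b
    simp only [hτ]
    rw [← Finset.sum_add_distrib]
    refine Finset.sum_congr rfl fun y _ => ?_
    rw [mul_add, add_mul, map_add, add_apply, inner_add_right]
  have hconj : ∀ w ∈ unitary A, w ∈ cuntzCone S → ∀ a, τ (w * a * star w) = τ a :=
    fun w hw hw' a => sum_inner_conj_eq hS ρ hρ hF hw hw' a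
  have h01 := hconj _ (hS.cuntzBranch_mem_unitary (i := 0) (j := 1) (by decide))
    (cuntzBranch_mem_cuntzCone hS 0 1) (S 0 * star (S 0))
  have h10 := hconj _ (hS.cuntzBranch_mem_unitary (i := 1) (j := 0) (by decide))
    (cuntzBranch_mem_cuntzCone hS 1 0) (S 0 * star (S 0))
  have hf := hconj _ hS.cuntzFlip_mem_unitary (cuntzFlip_mem_cuntzCone hS) (S 0 * star (S 0))
  rw [hS.branch_conj] at h01 h10
  rw [hS.flip_conj] at hf
  have hsplit : S 0 * star (S 0) = S 0 * (S 0 * star (S 0)) * star (S 0)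
      + S 0 * (S 1 * star (S 1)) * star (S 0) := by
    rw [← add_mul, ← mul_add, hS.sum_range, mul_one]
  -- Both halves of `S₀S₀⋆` have the value of `S₀S₀⋆` itself, so that value equals its double.
  have h0 : τ (S 0 * star (S 0)) = 0 := by
    have := congrArg τ hsplit
    rw [hadd, h01, h10] at this
    exact left_eq_add.1 this
  have h1 : τ 1 = 0 := by rw [← hS.sum_range, hadd, hf, h0, add_zero]
  have hterm : ∀ y, (inner ℂ (delta y) (ρ (S 0 * 1 * star (S 0)) (delta y)) : ℂ)
      = ((‖star (ρ (S 0)) (delta y)‖ ^ 2 : ℝ) : ℂ) := by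
    intro y
    rw [mul_one, map_mul, map_star, mul_apply_eq_comp, ← inner_star_apply_left,
      inner_self_eq_norm_sq_to_K]
    push_cast
    rfl
  -- This sum is `τ 1`; its terms are nonnegative, so each of them vanishes.
  have hsum : ∑ y ∈ F, ‖star (ρ (S 0)) (delta y)‖ ^ 2 = 0 := by
    have : ((∑ y ∈ F, ‖star (ρ (S 0)) (delta y)‖ ^ 2 : ℝ) : ℂ) = 0 := by
      rw [← h1, hτ, Complex.ofReal_sum]
      exact Finset.sum_congr rfl fun y _ => (hterm y).symm
    exact_mod_cast this
  have := (Finset.sum_eq_zero_iff_of_nonneg fun y _ => sq_nonneg _).1 hsum x hx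
  simpa using this

/-- If the Thompson group acts by permutations of the paths, then so do the range projections. -/
theorem range_proj_apply_delta (x : FreePath) :
    ρ (S 1 * star (S 1)) (delta x) = 0 ∨ ρ (S 1 * star (S 1)) (delta x) = delta x := by
  set ξ := ρ (S 1 * star (S 1)) (delta x) with hξ
  set O : Set FreePath := {y | ∃ w ∈ unitary A, w ∈ cuntzCone S ∧
    ρ (cuntzHalf S w) (delta x) = delta y} with hO
  have hfix : ∀ w, ρ (cuntzHalf S w) ξ = ξ := by
    intro w
    rw [hξ, ← mul_apply_eq_comp, ← map_mul, ← mul_assoc, hS.cuntzHalf_mul_one]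
  have hconst : ∀ y ∈ O, ξ y = ξ x := by
    rintro y ⟨w, -, -, h⟩
    rw [← inner_delta_left, ← inner_delta_left, ← h, ← inner_star_apply, ← map_star,
      star_cuntzHalf, hfix]
  have hxO : x ∈ O := ⟨1, one_mem _, one_mem_cuntzCone S, by
    rw [hS.cuntzHalf_one, map_one]; rfl⟩
  -- On a finite orbit the trace argument kills the component of `δₓ` in the first half; on an
  -- infinite orbit a square summable constant must be 0.
  by_cases hfin : O.Finite
  · right
    have hF : ∀ w ∈ unitary A, w ∈ cuntzCone S → ∀ y ∈ hfin.toFinset, ∀ z,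
        ρ (cuntzHalf S w) (delta y) = delta z → z ∈ hfin.toFinset := by
      intro w hw hw' y hy z hz
      obtain ⟨v, hv, hv', h⟩ := hfin.mem_toFinset.1 hy
      refine hfin.mem_toFinset.2 ⟨w * v, mul_mem hw hv, hS.cuntzCone_mul_mem hw' hv', ?_⟩
      rw [← hS.cuntzHalf_mul, map_mul, mul_apply_eq_comp, h, hz]
    have h0 := star_zero_apply_eq_zero hS ρ hρ hF (hfin.mem_toFinset.2 hxO)
    have h1 : ρ (S 0 * star (S 0)) (delta x) + ξ = delta x := by
      rw [hξ, ← add_apply, ← map_add, hS.sum_range, map_one]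
      rfl
    rwa [map_mul, map_star, mul_apply_eq_comp, h0, map_zero, zero_add] at h1
  · left
    have hzero : ξ x = 0 := by
      by_contra hne
      have hsum : Summable fun y => ‖ξ y‖ ^ 2 := by
        have := (lp.memℓp ξ).summable (by norm_num)
        simpa using this
      have hev := hsum.tendsto_cofinite_zero.eventually
        (gt_mem_nhds (pow_pos (norm_pos_iff.2 hne) 2))
      rw [Filter.eventually_cofinite] at hev
      refine hfin (hev.subset fun y hy => ?_)
      simp [hconst y hy]
    -- As `ξ` is the image of `δₓ` under a projection, `‖ξ‖²` is its coefficient at `x`.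
    have hin : (inner ℂ ξ ξ : ℂ) = 0 := by
      rw [← inner_delta_left] at hzero
      rw [← hzero]
      conv_lhs => rw [hξ]
      rw [← inner_star_apply, ← map_star, StarMul.star_mul, star_star, hξ, ← mul_apply_eq_comp,
        ← map_mul, mul_assoc, hS.isometry_mul]
    exact inner_self_eq_zero.1 hin

end Permuting

/-- An element acting as the indicator of a set of paths belongs to the cone. -/
theorem mem_cuntzCone_of_apply_delta {S : Fin 2 → A} (hS : GeneratesCuntzAlgebra S)
    (π : A →⋆ₐ[ℂ] (PathSpace →L[ℂ] PathSpace)) (hπ : ∀ i, π (S i) = creation i)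
    (hiso : ∀ x, ‖π x‖ = ‖x‖) {p : A}
    (hp : ∀ x, π p (delta x) = 0 ∨ π p (delta x) = delta x) : p ∈ cuntzCone S := by
  have hC := hS.isCuntzFamily
  have hinj : Function.Injective π := (AddMonoidHomClass.isometry_of_norm π hiso).injective
  -- With error below 1/2, one diagonal value of `b` cannot be near both 0 and 1. Hence the diagonal
  -- of `p` is constant on each cylinder where that of `b` is.
  obtain ⟨b, hb, hpb⟩ := Metric.dense_iff.1 hS.dense p (1 / 2) (by norm_num)
  rw [Metric.mem_ball, dist_eq_norm] at hb
  obtain ⟨d, hd⟩ := hC.exists_mem_cuntzWidth hpb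
  have hd' : π b ∈ cuntzWidth creation d := by
    have hle : cuntzWidth S d ≤ (cuntzWidth creation d).comap π.toAlgHom.toLinearMap := by
      refine Submodule.span_le.2 ?_
      rintro _ ⟨α, β, h, rfl⟩
      refine Submodule.subset_span ⟨α, β, h, ?_⟩
      change π _ = _
      rw [map_mul, map_star, map_cuntzWord, map_cuntzWord, funext hπ]
    exact hle hd
  obtain ⟨k, hk⟩ := exists_forall_inner_prepend_eq hd'
  have hclose : ∀ x, ‖(inner ℂ (delta x) (π b (delta x)) : ℂ)
      - inner ℂ (delta x) (π p (delta x))‖ < 1 / 2 := by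
    intro x
    rw [← inner_sub_right, ← sub_apply, ← map_sub]
    calc _ ≤ ‖delta x‖ * ‖π (b - p) (delta x)‖ := norm_inner_le_norm _ _
      _ ≤ ‖delta x‖ * (‖π (b - p)‖ * ‖delta x‖) :=
        mul_le_mul_of_nonneg_left (ContinuousLinearMap.le_opNorm _ _) (norm_nonneg _)
      _ < 1 / 2 := by rw [norm_delta, one_mul, mul_one, hiso]; exact hb
  refine hC.mem_cuntzCone_of_forall_mul_word (k := k) fun μ hμ => ?_
  have hπμ : ∀ z, π (cuntzWord S μ) (delta z) = delta (prepend μ z) := fun z => by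
    rw [map_cuntzWord, funext hπ, word_delta]
  by_cases h : ∃ z, π p (delta (prepend μ z)) = 0
  · obtain ⟨z, hz⟩ := h
    have : p * cuntzWord S μ = 0 := by
      apply hinj
      rw [map_zero]
      refine clm_ext fun y => ?_
      rw [map_mul, mul_apply_eq_comp, hπμ]
      rcases hp (prepend μ y) with h | h
      · rw [h]; rfl
      · exfalso
        have h1 := hclose (prepend μ z)
        have h2 := hclose (prepend μ y)
        rw [hz, inner_zero_right, sub_zero, hk k le_rfl μ hμ z y] at h1
        rw [h, inner_delta_delta_self, norm_sub_rev] at h2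
        have h3 := norm_sub_norm_le (1 : ℂ)
          (inner ℂ (delta (prepend μ y)) (π b (delta (prepend μ y))))
        rw [norm_one] at h3
        linarith
    rw [this]
    exact zero_mem _
  · push Not at h
    have : p * cuntzWord S μ = cuntzWord S μ := by
      apply hinj
      refine clm_ext fun y => ?_
      rw [map_mul, mul_apply_eq_comp, hπμ]
      exact (hp _).resolve_left (h y)
    rw [this]
    simpa [cuntzWord_nil] using monomial_mem_cuntzCone S μ []

end PathSpace

end Main

/-! ### The theorem -/

open PathSpace

theorem theorem3p12 {A : Type*} [CStarAlgebra A] [Nontrivial A] (S : Fin 2 → A)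
    (hS : GeneratesCuntzAlgebra S) (u : A) (hu : u ∈ unitary A) :
    (∃! l : A →⋆ₐ[ℂ] A, ∀ i, l (S i) = u * S i) ∧
    ∀ l : A →⋆ₐ[ℂ] A, (∀ i, l (S i) = u * S i) →
      ((∀ w ∈ thompsonV S, l w ∈ thompsonV S) ↔ u ∈ thompsonV S) := by
  have hC := hS.isCuntzFamily
  have hmul := @IsCuntzFamily.cuntzCone_mul_mem _ _ _ hC
  refine ⟨?_, fun l hl => ?_⟩
  · obtain ⟨l, hl, -⟩ := hS.exists_hom (hC.unitary_mul hu)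
    exact ⟨l, hl, fun l' hl' => hS.hom_ext fun i => (hl' i).trans (hl i).symm⟩
  obtain ⟨π, hπ, hiso⟩ := hS.exists_hom isCuntzFamily_creation
  have hV : ∀ {w : A}, w ∈ thompsonV S ↔ w ∈ unitary A ∧ w ∈ cuntzCone S :=
    mem_thompsonV_iff π hπ
  constructor
  · intro hlV
    have hρ : ∀ w ∈ unitary A, w ∈ cuntzCone S → ∀ x, ∃ y,
        (π.comp l) w (delta x) = delta y := by
      intro w hw hw' x
      obtain ⟨h1, h2⟩ := hV.1 (hlV w (hV.2 ⟨hw, hw'⟩))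
      exact exists_apply_delta_eq π hπ h1 h2 x
    have hdiag := range_proj_apply_delta hC (π.comp l) hρ
    have hP1 : l (S 1 * star (S 1)) ∈ cuntzCone S :=
      mem_cuntzCone_of_apply_delta hS π hπ hiso hdiag
    have hP0 : l (S 0 * star (S 0)) ∈ cuntzCone S := by
      refine mem_cuntzCone_of_apply_delta hS π hπ hiso fun x => ?_
      have e : π (l (S 0 * star (S 0))) (delta x) + π (l (S 1 * star (S 1))) (delta x)
          = delta x := by
        rw [← add_apply, ← map_add, ← map_add, hC.sum_range, map_one, map_one]
        rfl
      rcases hdiag x with h | h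
      · right
        rwa [show π (l (S 1 * star (S 1))) (delta x) = 0 from h, add_zero] at e
      · left
        rw [show π (l (S 1 * star (S 1))) (delta x) = delta x from h] at e
        exact add_eq_right.1 e
    have hlcone : ∀ w ∈ unitary A, w ∈ cuntzCone S → l w ∈ cuntzCone S :=
      fun w hw hw' => (hV.1 (hlV w (hV.2 ⟨hw, hw'⟩))).2
    have hflip := hlcone _ hC.cuntzFlip_mem_unitary (cuntzFlip_mem_cuntzCone hC)
    have hbranch : ∀ i j : Fin 2, i ≠ j → l (cuntzBranch S i j) ∈ cuntzCone S :=
      fun i j hij => hlcone _ (hC.cuntzBranch_mem_unitary hij) (cuntzBranch_mem_cuntzCone hC i j)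
    have hl0 : l (S 0) ∈ cuntzCone S := by
      rw [hC.zero_eq_branch, map_add, map_mul, map_mul l (_ * _), map_mul l (cuntzBranch S 1 0)]
      exact add_mem (hmul (hbranch 0 1 (by decide)) hP0)
        (hmul (hmul (hbranch 1 0 (by decide)) hflip) hP1)
    -- The flip carries the first generator to the second, so no further projection is needed.
    have hl1 : l (S 1) ∈ cuntzCone S := by
      rw [hC.one_eq_flip_mul, map_mul]
      exact hmul hflip hl0
    have hu' : u = l (S 0) * star (S 0) + l (S 1) * star (S 1) := by
      rw [hl, hl, mul_assoc, mul_assoc, ← mul_add, hC.sum_range, mul_one]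
    refine hV.2 ⟨hu, ?_⟩
    rw [hu']
    exact add_mem (hmul hl0 (star_mem_cuntzCone (gen_mem_cuntzCone S 0)))
      (hmul hl1 (star_mem_cuntzCone (gen_mem_cuntzCone S 1)))
  · intro huV w hw
    obtain ⟨h1, h2⟩ := hV.1 hw
    refine hV.2 ⟨Unitary.map_mem l h1, map_mem_cuntzCone hC l (fun i => ?_) h2⟩
    rw [hl]
    exact hmul (hV.1 huV).2 (gen_mem_cuntzCone S i)
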